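/- Let $n,m$ be non-negative integers and let $\Gamma\subset\mathbb{R}^n\times\mathbb{R}^m$ be a (full-rank) lattice in general position: the coordinate projections $p_1:\mathbb{R}^n\times\mathbb{R}^m\to\mathbb{R}^n$ and $p_2:\mathbb{R}^n\times\mathbb{R}^m\to\mathbb{R}^m$ are injective on $\Gamma$, and $p_1(\Gamma)$, $p_2(\Gamma)$ are dense in $\mathbb{R}^n$, $\mathbb{R}^m$ respectively. Let $\Gamma^*=\{\gamma^* : \langle\gamma,\gamma^*\rangle\in\mathbb{Z}\text{ for all }\gamma\in\Gamma\}$ be the dual lattice. Let $U\subset\mathbb{R}^n$ and $V\subset\mathbb{R}^m$ be bounded Riemann measurable sets (that is, bounded sets whose boundaries have Lebesgue measure zero), and put $$\Lambda(\Gamma,V)=\{p_1(\gamma):\gamma\in\Gamma,\ p_2(\gamma)\in V\}\subset\mathbb{R}^n,\qquad \Lambda^*(\Gamma,U)=\{p_2(\gamma^*):\gamma^*\in\Gamma^*,\ p_1(\gamma^*)\in U\}\subset\mathbb{R}^m.$$ For $\Lambda\subset\mathbb{R}^k$ write $E(\Lambda)=\{e^{2\pi i\langle\lambda,x\rangle}\}_{\lambda\in\Lambda}$.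 A system $\{f_j\}$ in a Hilbert space $H$ is a frame if there are constants $A,B>0$ with $A\|f\|^2\le\sum_j|\langle f,f_j\rangle|^2\le B\|f\|^2$ for all $f\in H$; it is a Riesz sequence if there are $A,B>0$ with $A\sum_j|c_j|^2\le\|\sum_j c_jf_j\|^2\le B\sum_j|c_j|^2$ for all finite systems of scalars $\{c_j\}$; it is a Riesz basis if every $f\in H$ has a unique (unconditionally convergent) expansion $f=\sum_j c_jf_j$, and $A\|f\|^2\le\sum_j|c_j|^2\le B\|f\|^2$ with constants $A,B>0$ independent of $f$. Suppose that either $\partial V\cap p_2(\Gamma)=\emptyset$, or $m=1$ and $V$ is a semi-closed interval $[a,b)$ or $(a,b]$ with $a<b$. Then: 1. if $E(\Lambda^*(\Gamma,U))$ is a frame in $L^2(V)$, then $E(\Lambda(\Gamma,V))$ is a Riesz sequence in $L^2(U)$; 2. if $E(\Lambda^*(\Gamma,U))$ is a Riesz sequence in $L^2(V)$, then $E(\Lambda(\Gamma,V))$ is a frame in $L^2(U)$; 3. if $E(\Lambda^*(\Gamma,U))$ is a Riesz basis in $L^2(V)$, then $E(\Lambda(\Gamma,V))$ is a Riesz basis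 in $L^2(U)$. -/

import Mathlib

open MeasureTheory

namespace ModelSetDuality

/-- The Euclidean space `ℝᵏ`. -/
abbrev Euc (k : ℕ) : Type := EuclideanSpace ℝ (Fin k)

section Systems

variable {ι : Type*} {H : Type*} [NormedAddCommGroup H] [InnerProductSpace ℂ H]

/-- `f` is a frame in `H`: `A ‖x‖² ≤ ∑ₙ |⟨x, fₙ⟩|² ≤ B ‖x‖²` for all `x`. -/
def IsFrame (f : ι → H) : Prop :=
  ∃ A B : ℝ, 0 < A ∧ 0 < B ∧ ∀ x : H,
    Summable (fun i => ‖(inner ℂ (f i) x : ℂ)‖ ^ 2) ∧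
    A * ‖x‖ ^ 2 ≤ ∑' i, ‖(inner ℂ (f i) x : ℂ)‖ ^ 2 ∧
    ∑' i, ‖(inner ℂ (f i) x : ℂ)‖ ^ 2 ≤ B * ‖x‖ ^ 2

/-- `f` is a Riesz sequence in `H`: `A ∑ |cₙ|² ≤ ‖∑ cₙ fₙ‖² ≤ B ∑ |cₙ|²` for all finite
systems of scalars. -/
def IsRieszSequence (f : ι → H) : Prop :=
  ∃ A B : ℝ, 0 < A ∧ 0 < B ∧ ∀ (s : Finset ι) (c : ι → ℂ),
    A * ∑ i ∈ s, ‖c i‖ ^ 2 ≤ ‖∑ i ∈ s, c i • f i‖ ^ 2 ∧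
    ‖∑ i ∈ s, c i • f i‖ ^ 2 ≤ B * ∑ i ∈ s, ‖c i‖ ^ 2

/-- `f` is a Riesz basis of `H`: every `x` has a unique expansion `x = ∑ cₙ fₙ`, and
`A ‖x‖² ≤ ∑ |cₙ|² ≤ B ‖x‖²` with `A`, `B` independent of `x`. -/
def IsRieszBasis (f : ι → H) : Prop :=
  ∃ A B : ℝ, 0 < A ∧ 0 < B ∧ ∀ x : H, ∃ c : ι → ℂ,
    HasSum (fun i => c i • f i) x ∧
    (∀ c' : ι → ℂ, HasSum (fun i => c' i • f i) x → c' = c) ∧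
    Summable (fun i => ‖c i‖ ^ 2) ∧
    A * ‖x‖ ^ 2 ≤ ∑' i, ‖c i‖ ^ 2 ∧
    ∑' i, ‖c i‖ ^ 2 ≤ B * ‖x‖ ^ 2

end Systems

/-- A bounded set whose boundary has Lebesgue measure zero. -/
structure RiemannMeasurable {k : ℕ} (S : Set (Euc k)) : Prop where
  bounded : Bornology.IsBounded S
  null_frontier : volume (frontier S) = 0

/-- The exponential function `x ↦ exp (2 π i ⟨lam, x⟩)`. -/
noncomputable def expFun {k : ℕ} (lam : Euc k) (x : Euc k) : ℂ :=
  Complex.exp (2 * (Real.pi : ℂ) * Complex.I * ((inner ℝ lam x : ℝ) : ℂ))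

theorem continuous_expFun {k : ℕ} (lam : Euc k) : Continuous (expFun lam) := by
  unfold expFun
  fun_prop

theorem norm_expFun {k : ℕ} (lam x : Euc k) : ‖expFun lam x‖ = 1 := by
  have h : 2 * (Real.pi : ℂ) * Complex.I * ((inner ℝ lam x : ℝ) : ℂ) =
      ((2 * Real.pi * (inner ℝ lam x : ℝ) : ℝ) : ℂ) * Complex.I := by
    push_cast
    ring
  rw [expFun, h, Complex.norm_exp_ofReal_mul_I]

theorem memLp_expFun {k : ℕ} {S : Set (Euc k)} (hS : Bornology.IsBounded S) (lam : Euc k) :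
    MemLp (expFun lam) 2 (volume.restrict S) := by
  haveI : IsFiniteMeasure (volume.restrict S) :=
    ⟨by rw [Measure.restrict_apply_univ]; exact hS.measure_lt_top⟩
  exact MemLp.of_bound (continuous_expFun lam).aestronglyMeasurable 1
    (Filter.Eventually.of_forall fun x => (norm_expFun lam x).le)

/-- The exponential system `E(Λ)`, indexed by `Λ`, as vectors of `L²(S)`, for bounded `S`. -/
noncomputable def expSystem {k : ℕ} (Lam : Set (Euc k)) {S : Set (Euc k)}
    (hS : Bornology.IsBounded S) : Lam → Lp ℂ 2 (volume.restrict S) :=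
  fun lam => (memLp_expFun hS (lam : Euc k)).toLp (expFun (lam : Euc k))

/-- The dual lattice: all vectors with integral Euclidean inner product with every element
of `Γ`. -/
def dualLattice {n m : ℕ} (Γ : Submodule ℤ (Euc n × Euc m)) :
    Submodule ℤ (Euc n × Euc m) where
  carrier := {y | ∀ x ∈ Γ, ∃ k : ℤ, (inner ℝ x.1 y.1 : ℝ) + (inner ℝ x.2 y.2 : ℝ) = (k : ℝ)}
  zero_mem' := fun x _ => ⟨0, by simp⟩
  add_mem' := by
    intro a b ha hb x hx
    obtain ⟨k, hk⟩ := ha x hx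
    obtain ⟨l, hl⟩ := hb x hx
    refine ⟨k + l, ?_⟩
    simp only [Prod.fst_add, Prod.snd_add, inner_add_right]
    push_cast
    linarith
  smul_mem' := by
    intro c a ha x hx
    obtain ⟨k, hk⟩ := ha x hx
    refine ⟨c * k, ?_⟩
    rw [← Int.cast_smul_eq_zsmul ℝ c a]
    simp only [Prod.smul_fst, Prod.smul_snd, inner_smul_right]
    push_cast
    rw [← hk]
    ring

/-- Both coordinate projections are injective on `Γ` and have dense images. -/
structure GeneralPosition {n m : ℕ} (Γ : Submodule ℤ (Euc n × Euc m)) : Prop where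
  injOn_fst : Set.InjOn Prod.fst (Γ : Set (Euc n × Euc m))
  injOn_snd : Set.InjOn Prod.snd (Γ : Set (Euc n × Euc m))
  dense_fst : Dense (Prod.fst '' (Γ : Set (Euc n × Euc m)))
  dense_snd : Dense (Prod.snd '' (Γ : Set (Euc n × Euc m)))

/-- `Λ(Γ, V) = {p₁(γ) : γ ∈ Γ, p₂(γ) ∈ V}`. -/
def modelSet {n m : ℕ} (Γ : Submodule ℤ (Euc n × Euc m)) (V : Set (Euc m)) : Set (Euc n) :=
  {x | ∃ y ∈ Γ, y.2 ∈ V ∧ y.1 = x}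

/-- `Λ*(Γ, U) = {p₂(γ*) : γ* ∈ Γ*, p₁(γ*) ∈ U}`. -/
def dualModelSet {n m : ℕ} (Γ : Submodule ℤ (Euc n × Euc m)) (U : Set (Euc n)) : Set (Euc m) :=
  {x | ∃ y ∈ dualLattice Γ, y.1 ∈ U ∧ y.2 = x}

/-- `m = 1` and `V` is an interval `[a, b)` or `(a, b]` of `ℝ`. -/
def IsSemiClosedInterval {m : ℕ} (V : Set (Euc m)) : Prop :=
  m = 1 ∧ ∃ a b : ℝ, a < b ∧
    (V = {v | ∀ i, v i ∈ Set.Ico a b} ∨ V = {v | ∀ i, v i ∈ Set.Ioc a b})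

end ModelSetDuality

open MeasureTheory Filter Topology FourierTransform SchwartzMap

namespace ModelSetDuality

/-! Write C for `poissonConst Γ`, the constant in Poisson summation between Γ* and Γ. The duality
comes from testing the hypothesis on bumps φ((y - p₂γ)/ε) of shrinking size ε placed at the points
p₂γ.

Frame to Riesz sequence. For a finite sum f(x) = ∑ c_γ exp(2πi⟨p₁γ, x⟩) over points with p₂γ ∈ V,
take F_ε(y) = ∑ c_γ φ((y - p₂γ)/ε). For small ε the bumps are disjoint and lie in V, so ‖F_ε‖² = ε^m
‖φ‖² ∑|c_γ|². Since ⟨γ, γ*⟩ is an integer, the coefficient of F_ε at frequency p₂γ* is ε^m f(p₁γ*)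
φ̂(ε p₂γ*). Poisson summation gives equidistribution of Γ* in strips: ε^m ∑ |f(p₁γ*)|² |φ̂(ε p₂γ*)|²
over p₁γ* ∈ U tends to C ‖f‖²_{L²(U)} ‖φ‖². In the limit, frame bounds A, B become Riesz bounds A/C,
B/C.

Riesz sequence to frame. For a Schwartz f vanishing off U, use the coefficients f(p₁γ*) φ̂(ε p₂γ*).
Poisson summation turns their exponential sum into C ε^{-m} ∑ f̂(p₁γ) φ((z - p₂γ)/ε), an infinite
sum of bumps over Γ. As ε → 0 its rescaled L²(V) norm keeps only the diagonal terms with p₂γ ∈ V,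
that is, the frame sum of f. Such f are dense in L²(U), and the bounds are again A/C, B/C.

The condition on V enters only through `IsWindow`: from a suitable side, a small bump at p₂γ lies
wholly inside or wholly outside V according to whether p₂γ ∈ V. The third claim follows because a
Riesz basis is exactly a Riesz sequence that is also a frame. -/

/-- The polynomial weight `(1 + ‖x‖)⁻ʳ`. -/
noncomputable def wt {E : Type*} [NormedAddCommGroup E] (r : ℕ) (x : E) : ℝ := ((1 + ‖x‖) ^ r)⁻¹

/-! ### Polynomial weights and their sums over lattices. -/

section Weight

variable {E : Type*} [NormedAddCommGroup E]

theorem wt_pos (r : ℕ) (x : E) : 0 < wt r x := by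
  unfold wt; positivity

theorem wt_le_one (r : ℕ) (x : E) : wt r x ≤ 1 :=
  inv_le_one_of_one_le₀ (one_le_pow₀ (by linarith [norm_nonneg x]))

theorem wt_anti {F : Type*} [NormedAddCommGroup F] (r : ℕ) {x : E} {y : F} (h : ‖x‖ ≤ ‖y‖) :
    wt r y ≤ wt r x := by
  unfold wt
  gcongr

/-- A Peetre-type inequality: 1 + ‖y‖ ≤ (1 + ‖x‖)(1 + ‖x + y‖). It makes decay estimates uniform
under bounded translations. -/
theorem wt_add_le (r : ℕ) (x y : E) : wt r (x + y) ≤ (1 + ‖x‖) ^ r * wt r y := by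
  unfold wt
  rw [inv_eq_one_div, div_le_iff₀ (by positivity), mul_assoc, mul_left_comm, ← mul_pow,
    inv_mul_eq_div, le_div_iff₀ (by positivity), one_mul]
  gcongr
  have h : ‖y‖ ≤ ‖x‖ + ‖x + y‖ := by
    calc ‖y‖ = ‖(x + y) - x‖ := by congr 1; abel
      _ ≤ ‖x + y‖ + ‖x‖ := norm_sub_le _ _
      _ = _ := add_comm _ _
  nlinarith [norm_nonneg x, norm_nonneg (x + y)]

theorem summable_wt [NormedSpace ℝ E] [FiniteDimensional ℝ E] (L : Submodule ℤ E)
    [DiscreteTopology L] [IsZLattice ℝ L] {r : ℕ} (hr : Module.finrank ℝ E < r) :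
    Summable fun z : L => wt r (z : E) := by
  classical
  have hr' : Module.finrank ℤ L < r := by rwa [ZLattice.rank ℝ L]
  have h1 := ZLattice.summable_norm_pow_inv L r hr'
  -- At the origin the convention 0⁻¹ = 0 makes the comparison term smaller than the weight, so that
  -- point is excluded.
  refine Summable.of_norm_bounded_eventually h1 ?_
  have : ({0} : Set L).Finite := Set.finite_singleton 0
  filter_upwards [this.compl_mem_cofinite] with z hz
  have hz' : 0 < ‖z‖ := norm_pos_iff.2 hz
  rw [Real.norm_of_nonneg (wt_pos _ _).le, wt, inv_pow]
  apply inv_anti₀ (by positivity)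
  gcongr
  simp

end Weight

/-! ### Periodization and Poisson summation for the integer lattice. -/

section Periodization

variable {ι : Type*}

/-- The embedding of `ℤ^ι` into `ℝ^ι`. -/
def intVec (k : ι → ℤ) : ι → ℝ := fun i => (k i : ℝ)

/-- The projection of `ℝ^ι` onto the torus. -/
def toTorus : C(ι → ℝ, UnitAddTorus ι) where
  toFun x := fun i => (x i : UnitAddCircle)
  continuous_toFun := by fun_prop

theorem isQuotientMap_toTorus : IsQuotientMap (toTorus (ι := ι)) :=
  (IsOpenQuotientMap.piMap fun _ : ι =>
    QuotientAddGroup.isOpenQuotientMap_mk (N := AddSubgroup.zmultiples (1 : ℝ))).isQuotientMap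

theorem exists_eq_add_intVec {x y : ι → ℝ} (h : toTorus x = toTorus y) :
    ∃ k, y = x + intVec k := by
  have h' : ∀ i, ∃ k : ℤ, y i = x i + k := by
    intro i
    have hi : ((x i : ℝ) : UnitAddCircle) = (y i : ℝ) := congrFun h i
    have hz : ((y i - x i : ℝ) : UnitAddCircle) = 0 := by
      rw [AddCircle.coe_sub, hi, sub_self]
    obtain ⟨k, hk⟩ := (AddCircle.coe_eq_zero_iff 1).1 hz
    refine ⟨k, ?_⟩
    rw [zsmul_one] at hk
    linarith
  choose k hk using h'
  exact ⟨k, funext hk⟩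

theorem toTorus_add_intVec (x : ι → ℝ) (k : ι → ℤ) : toTorus (x + intVec k) = toTorus x := by
  ext i
  simp [toTorus, intVec]

variable [Fintype ι]

/-- The integer lattice in `ℝ^ι`. -/
abbrev intLattice (ι : Type*) [Fintype ι] : Submodule ℤ (ι → ℝ) :=
  Submodule.span ℤ (Set.range (Pi.basisFun ℝ ι))

theorem intVec_mem_intLattice (k : ι → ℤ) : intVec k ∈ intLattice ι := by
  rw [Module.Basis.mem_span_iff_repr_mem ℤ (Pi.basisFun ℝ ι)]
  intro i
  exact ⟨k i, by simp [intVec]⟩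

/-- The identification of `ℤ^ι` with the integer lattice. -/
noncomputable def intVecEquiv : (ι → ℤ) ≃ intLattice ι :=
  Equiv.ofBijective (fun k => ⟨intVec k, intVec_mem_intLattice k⟩) <| by
    constructor
    · intro k l h
      ext i
      have := congrFun (Subtype.ext_iff.1 h) i
      simpa [intVec] using this
    · rintro ⟨z, hz⟩
      rw [Module.Basis.mem_span_iff_repr_mem ℤ (Pi.basisFun ℝ ι)] at hz
      choose k hk using hz
      refine ⟨k, Subtype.ext (funext fun i => ?_)⟩
      simpa [intVec] using hk i

theorem coe_intVecEquiv (k : ι → ℤ) : (intVecEquiv k : ι → ℝ) = intVec k := rfl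

theorem summable_wt_intVec {r : ℕ} (hr : Fintype.card ι < r) :
    Summable fun k : ι → ℤ => wt r (intVec k) := by
  have h := summable_wt (intLattice ι) (r := r) (by simpa using hr)
  exact (intVecEquiv (ι := ι)).summable_iff.2 h

/-- The half-open unit cube. -/
def unitCube (ι : Type*) : Set (ι → ℝ) := {x | ∀ i, x i ∈ Set.Ioc ((0 : ι → ℝ) i) ((0 : ι → ℝ) i + 1)}

/-- Torus Fourier coefficients are integrals over products of `Ioc`, while the fundamental domain of
a lattice is a product of `Ico`; the two cubes differ by a null set. -/
theorem unitCube_ae_eq : unitCube ι =ᵐ[volume] ZSpan.fundamentalDomain (Pi.basisFun ℝ ι) := by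
  have h1 : unitCube ι = Set.univ.pi fun i => Set.Ioc ((0 : ι → ℝ) i) ((1 : ι → ℝ) i) := by
    ext x; simp [unitCube]
  have h2 : ZSpan.fundamentalDomain (Pi.basisFun ℝ ι) =
      Set.univ.pi fun i => Set.Ico ((0 : ι → ℝ) i) ((1 : ι → ℝ) i) := by
    rw [ZSpan.fundamentalDomain_pi_basisFun]; rfl
  rw [h1, h2]
  exact Measure.univ_pi_Ioc_ae_eq_Icc.trans Measure.univ_pi_Ico_ae_eq_Icc.symm

theorem norm_le_one_of_mem_unitCube {x : ι → ℝ} (hx : x ∈ unitCube ι) : ‖x‖ ≤ 1 := by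
  rw [pi_norm_le_iff_of_nonneg zero_le_one]
  intro i
  have := hx i
  simp only [Pi.zero_apply, zero_add, Set.mem_Ioc] at this
  rw [Real.norm_eq_abs, abs_le]
  constructor <;> linarith

theorem volume_unitCube_lt_top : volume (unitCube ι) < ⊤ := by
  refine lt_of_le_of_lt (measure_mono fun x hx => ?_)
    (Metric.isBounded_closedBall (x := (0 : ι → ℝ)) (r := 1)).measure_lt_top
  simpa using norm_le_one_of_mem_unitCube hx

theorem integral_eq_tsum_unitCube {g : (ι → ℝ) → ℂ} (hg : Integrable g) :
    ∫ x, g x = ∑' k : ι → ℤ, ∫ x in unitCube ι, g (x + intVec k) := by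
  have : VAddInvariantMeasure (Submodule.span ℤ (Set.range (Pi.basisFun ℝ ι))) (ι → ℝ) volume :=
    ⟨fun c s _ => measure_preimage_add volume (c : ι → ℝ) s⟩
  rw [(ZSpan.isAddFundamentalDomain (Pi.basisFun ℝ ι) volume).integral_eq_tsum'' g hg,
    ← (intVecEquiv (ι := ι)).tsum_eq]
  refine tsum_congr fun k => ?_
  rw [setIntegral_congr_set unitCube_ae_eq]
  refine integral_congr_ae (ae_of_all _ fun x => ?_)
  simp [Submodule.vadd_def, coe_intVecEquiv, add_comm]

theorem mFourier_toTorus (l : ι → ℤ) (x : ι → ℝ) : UnitAddTorus.mFourier l (toTorus x) =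
    Complex.exp (2 * Real.pi * Complex.I * ((∑ i, (l i : ℝ) * x i : ℝ) : ℂ)) := by
  simp only [UnitAddTorus.mFourier, toTorus, ContinuousMap.coe_mk, fourier_coe_apply]
  rw [← Complex.exp_sum]
  congr 1
  push_cast
  rw [Finset.mul_sum]
  exact Finset.sum_congr rfl fun i _ => by ring

variable {r : ℕ} {F : (ι → ℝ) → ℂ} {C : ℝ}

/-- Continuity is local, so the Weierstrass M-test is needed only on a ball around each point, where
`wt_add_le` gives a uniform summable majorant. -/
theorem continuous_tsum_add_intVec (hr : Fintype.card ι < r) (hF : Continuous F) (hC : 0 ≤ C)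
    (hdec : ∀ x, ‖F x‖ ≤ C * wt r x) : Continuous fun x => ∑' k : ι → ℤ, F (x + intVec k) := by
  rw [continuous_iff_continuousAt]
  intro x
  refine (continuousOn_tsum (s := Metric.ball 0 (‖x‖ + 1)) (fun k => ?_)
    ((summable_wt_intVec hr).mul_left (C * (1 + (‖x‖ + 1)) ^ r)) ?_).continuousAt
    (Metric.isOpen_ball.mem_nhds (by simp))
  · exact (hF.comp (continuous_id.add continuous_const)).continuousOn
  · intro k y hy
    refine (hdec _).trans ?_
    rw [mul_assoc]
    gcongr
    refine (wt_add_le _ _ _).trans ?_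
    have : ‖y‖ ≤ ‖x‖ + 1 := by simpa using (Metric.mem_ball.1 hy).le
    gcongr
    exact (wt_pos _ _).le

theorem integrable_of_le_wt {E : Type*} [NormedAddCommGroup E] [NormedSpace ℝ E]
    [FiniteDimensional ℝ E] [MeasurableSpace E] [BorelSpace E] {μ : Measure E}
    [μ.IsAddHaarMeasure] {F : E → ℂ} (hr : Module.finrank ℝ E < r) (hF : Continuous F)
    (hdec : ∀ x, ‖F x‖ ≤ C * wt r x) : Integrable F μ := by
  have h := (integrable_one_add_norm (E := E) (μ := μ) (r := r) (by exact_mod_cast hr)).const_mul C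
  refine h.mono' hF.aestronglyMeasurable (ae_of_all _ fun x => ?_)
  refine (hdec x).trans (le_of_eq ?_)
  rw [wt, Real.rpow_neg (by positivity), Real.rpow_natCast]

/-- Poisson summation for the lattice `ℤ^ι`. -/
theorem tsum_intVec_eq_tsum_integral (hr : Fintype.card ι < r) (hF : Continuous F) (hC : 0 ≤ C)
    (hdec : ∀ x, ‖F x‖ ≤ C * wt r x)
    (hsum : Summable fun l : ι → ℤ =>
      ∫ x, Complex.exp (2 * Real.pi * Complex.I * ((-∑ i, (l i : ℝ) * x i : ℝ) : ℂ)) * F x) :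
    ∑' k : ι → ℤ, F (intVec k) = ∑' l : ι → ℤ,
      ∫ x, Complex.exp (2 * Real.pi * Complex.I * ((-∑ i, (l i : ℝ) * x i : ℝ) : ℂ)) * F x := by
  -- The periodization of F. Invariance under integer translations makes it descend to a continuous
  -- function Q on the torus.
  let P : C(ι → ℝ, ℂ) := ⟨_, continuous_tsum_add_intVec hr hF hC hdec⟩
  have hP : Function.FactorsThrough P (toTorus (ι := ι)) := by
    intro x y hxy
    obtain ⟨l, rfl⟩ := exists_eq_add_intVec hxy
    change ∑' k : ι → ℤ, F (x + intVec k) = ∑' k : ι → ℤ, F (x + intVec l + intVec k)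
    rw [← (Equiv.addLeft l).tsum_eq]
    refine tsum_congr fun k => ?_
    congr 1
    ext i
    simp [intVec, add_assoc]
  let Q : C(UnitAddTorus ι, ℂ) := isQuotientMap_toTorus.lift P hP
  have hQ (x : ι → ℝ) : Q (toTorus x) = P x :=
    congrArg (fun f : C(ι → ℝ, ℂ) => f x) (isQuotientMap_toTorus.lift_comp P hP)
  -- Unfolding: characters are periodic, so summing integrals over translated cubes recovers the
  -- integral over the whole space.
  have hcoeff (l : ι → ℤ) : UnitAddTorus.mFourierCoeff Q l =
      ∫ x, Complex.exp (2 * Real.pi * Complex.I * ((-∑ i, (l i : ℝ) * x i : ℝ) : ℂ)) * F x := by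
    set e : (ι → ℝ) → ℂ := fun x => UnitAddTorus.mFourier (-l) (toTorus x) with he
    have he1 (x : ι → ℝ) :
        e x = Complex.exp (2 * Real.pi * Complex.I * ((-∑ i, (l i : ℝ) * x i : ℝ) : ℂ)) := by
      simp only [he, mFourier_toTorus]
      simp
    have he2 (x : ι → ℝ) : ‖e x‖ ≤ 1 := by
      have := (UnitAddTorus.mFourier (-l)).norm_coe_le_norm (toTorus x)
      rwa [UnitAddTorus.mFourier_norm] at this
    have hec : Continuous e := (UnitAddTorus.mFourier (-l)).continuous.comp toTorus.continuous
    have hdec' (x : ι → ℝ) : ‖e x * F x‖ ≤ C * wt r x := by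
      rw [norm_mul]
      exact (mul_le_of_le_one_left (norm_nonneg _) (he2 x)).trans (hdec x)
    have hint : Integrable (fun x => e x * F x) :=
      integrable_of_le_wt (by simpa using hr) (hec.mul hF) hdec'
    simp_rw [← he1]
    rw [integral_eq_tsum_unitCube hint, UnitAddTorus.mFourierCoeff_eq_integral Q l 0]
    change ∫ x in unitCube ι, e x • Q (toTorus x) = _
    have : IsFiniteMeasure (volume.restrict (unitCube ι)) :=
      ⟨by simpa using volume_unitCube_lt_top⟩
    have hbd (k : ι → ℤ) (x : ι → ℝ) (hx : x ∈ unitCube ι) :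
        ‖e (x + intVec k) * F (x + intVec k)‖ ≤ C * 2 ^ r * wt r (intVec k) := by
      refine (hdec' _).trans ?_
      rw [mul_assoc]
      gcongr
      refine (wt_add_le _ _ _).trans ?_
      have := norm_le_one_of_mem_unitCube hx
      gcongr
      · exact (wt_pos _ _).le
      · linarith
    rw [integral_tsum_of_summable_integral_norm]
    · refine integral_congr_ae (ae_of_all _ fun x => ?_)
      change e x • Q (toTorus x) = _
      rw [hQ, smul_eq_mul]
      change _ * ∑' k : ι → ℤ, F (x + intVec k) = _
      rw [← tsum_mul_left]
      simp only [he, toTorus_add_intVec]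
    · intro k
      exact (hint.comp_add_right _).integrableOn
    · refine Summable.of_nonneg_of_le (fun k => integral_nonneg fun _ => norm_nonneg _)
        (fun k => ?_) (((summable_wt_intVec hr).mul_left (C * 2 ^ r)).mul_left
          (volume.real (unitCube ι)))
      refine (le_abs_self _).trans ?_
      rw [← Real.norm_eq_abs]
      refine (norm_setIntegral_le_of_norm_le_const volume_unitCube_lt_top fun x hx => ?_).trans
        (le_of_eq (mul_comm _ _))
      rw [norm_norm]
      exact hbd k x hx
  have hs : Summable (UnitAddTorus.mFourierCoeff Q) := by
    simpa only [funext hcoeff] using hsum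
  -- With summable coefficients the Fourier series of Q converges to Q pointwise; at the origin
  -- every character equals 1.
  have h := (UnitAddTorus.hasSum_mFourier_series_apply_of_summable hs (toTorus 0)).tsum_eq
  rw [hQ] at h
  change _ = ∑' k : ι → ℤ, F (0 + intVec k) at h
  simp only [zero_add] at h
  rw [← h]
  refine tsum_congr fun l => ?_
  rw [hcoeff, mFourier_toTorus]
  simp

end Periodization

/-- Continuous functions with polynomial decay of order `r`. -/
def Decays {E : Type*} [NormedAddCommGroup E] (r : ℕ) (F : E → ℂ) : Prop :=
  Continuous F ∧ ∃ C, 0 ≤ C ∧ ∀ x, ‖F x‖ ≤ C * wt r x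

/-! ### Poisson summation for a lattice and its dual. -/

section LatticePoisson

variable {n m : ℕ}

/-- The product carries the sup norm, so the weight of z is the smaller of the weights of its
components, and both are at most 1. -/
theorem norm_mul_wt_le {E F : Type*} [NormedAddCommGroup E] [NormedAddCommGroup F] (r : ℕ)
    (z : E × F) : wt r z.1 * wt r z.2 ≤ wt r z := by
  rcases le_total ‖z.1‖ ‖z.2‖ with h | h
  · have : wt r z.2 ≤ wt r z := wt_anti r (by simp [Prod.norm_def, h])
    exact (mul_le_of_le_one_left (wt_pos _ _).le (wt_le_one _ _)).trans this
  · have : wt r z.1 ≤ wt r z := wt_anti r (by simp [Prod.norm_def, h])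
    exact (mul_le_of_le_one_right (wt_pos _ _).le (wt_le_one _ _)).trans this

/-- The Euclidean inner product on the product space. -/
noncomputable def pairing (x y : Euc n × Euc m) : ℝ := inner ℝ x.1 y.1 + inner ℝ x.2 y.2

theorem eq_zero_of_pairing_self {x : Euc n × Euc m} (h : pairing x x = 0) : x = 0 := by
  have h1 := real_inner_self_nonneg (x := x.1)
  have h2 := real_inner_self_nonneg (x := x.2)
  unfold pairing at h
  exact Prod.ext (inner_self_eq_zero.1 (by linarith : (inner ℝ x.1 x.1 : ℝ) = 0))
    (inner_self_eq_zero.1 (by linarith : (inner ℝ x.2 x.2 : ℝ) = 0))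

/-- The pairing as a bilinear map. -/
noncomputable def pairingₗ : (Euc n × Euc m) →ₗ[ℝ] (Euc n × Euc m) →ₗ[ℝ] ℝ :=
  LinearMap.mk₂ ℝ pairing
    (fun x y z => by simp only [pairing, Prod.fst_add, Prod.snd_add, inner_add_left]; ring)
    (fun c x y => by
      simp only [pairing, Prod.smul_fst, Prod.smul_snd, real_inner_smul_left, smul_eq_mul]; ring)
    (fun x y z => by simp only [pairing, Prod.fst_add, Prod.snd_add, inner_add_right]; ring)
    (fun c x y => by
      simp only [pairing, Prod.smul_fst, Prod.smul_snd, real_inner_smul_right, smul_eq_mul]; ring)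

theorem pairingₗ_apply (x y : Euc n × Euc m) : pairingₗ x y = pairing x y := rfl

theorem mem_dualLattice {Γ : Submodule ℤ (Euc n × Euc m)} {y : Euc n × Euc m} :
    y ∈ dualLattice Γ ↔ ∀ x ∈ Γ, ∃ k : ℤ, pairing x y = k := Iff.rfl

variable (Γ : Submodule ℤ (Euc n × Euc m)) [DiscreteTopology Γ] [IsZLattice ℝ Γ]

/-- The index type of a chosen basis of the lattice. -/
abbrev BasisIndex : Type := Module.Free.ChooseBasisIndex ℤ Γ

/-- A chosen `ℤ`-basis of the lattice. -/
noncomputable def latticeBasis : Module.Basis (BasisIndex Γ) ℤ Γ := Module.Free.chooseBasis ℤ Γ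

theorem card_basisIndex : Fintype.card (BasisIndex Γ) = n + m := by
  rw [← Module.finrank_eq_card_basis ((latticeBasis Γ).ofZLatticeBasis ℝ Γ)]
  simp

/-- Coordinates on the ambient space given by pairing with the basis of the lattice. -/
noncomputable def dualCoord : (Euc n × Euc m) →ₗ[ℝ] (BasisIndex Γ → ℝ) :=
  LinearMap.pi fun i => pairingₗ (latticeBasis Γ i : Euc n × Euc m)

/-- A vector pairing to zero with a basis of Γ, which spans over ℝ, pairs to zero with itself. -/
theorem dualCoord_injective : Function.Injective (dualCoord Γ) := by
  rw [← LinearMap.ker_eq_bot, LinearMap.ker_eq_bot']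
  intro z hz
  apply eq_zero_of_pairing_self
  have h : pairingₗ.flip z = 0 := by
    refine ((latticeBasis Γ).ofZLatticeBasis ℝ Γ).ext fun i => ?_
    rw [Module.Basis.ofZLatticeBasis_apply]
    exact congrFun hz i
  exact LinearMap.congr_fun h z

/-- `dualCoord` as a continuous linear equivalence. -/
noncomputable def dualCoordEquiv : (Euc n × Euc m) ≃L[ℝ] (BasisIndex Γ → ℝ) :=
  (LinearEquiv.ofInjectiveOfFinrankEq (dualCoord Γ) (dualCoord_injective Γ)
    (by simp [card_basisIndex Γ])).toContinuousLinearEquiv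

theorem dualCoordEquiv_apply (z : Euc n × Euc m) (i : BasisIndex Γ) :
    dualCoordEquiv Γ z i = pairing (latticeBasis Γ i : Euc n × Euc m) z := rfl

theorem pairing_basis_sum (l : BasisIndex Γ → ℤ) (z : Euc n × Euc m) :
    pairing ((latticeBasis Γ).equivFun.symm l : Euc n × Euc m) z =
      ∑ i, (l i : ℝ) * dualCoordEquiv Γ z i := by
  rw [Module.Basis.equivFun_symm_apply, ← pairingₗ_apply]
  simp only [Submodule.coe_sum, Submodule.coe_smul_of_tower, map_sum, LinearMap.sum_apply]
  refine Finset.sum_congr rfl fun i _ => ?_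
  rw [map_zsmul, LinearMap.smul_apply, pairingₗ_apply, dualCoordEquiv_apply, zsmul_eq_mul]

theorem dualCoordEquiv_symm_mem (k : BasisIndex Γ → ℤ) :
    (dualCoordEquiv Γ).symm (intVec k) ∈ dualLattice Γ := by
  intro x hx
  change ∃ _, pairing _ _ = _
  obtain ⟨l, hl⟩ := (latticeBasis Γ).equivFun.symm.surjective ⟨x, hx⟩
  refine ⟨∑ i, l i * k i, ?_⟩
  have : x = ((latticeBasis Γ).equivFun.symm l : Euc n × Euc m) := by rw [hl]
  rw [this, pairing_basis_sum, ContinuousLinearEquiv.apply_symm_apply]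
  simp [intVec]

/-- Parametrization of the dual lattice by integer vectors. -/
noncomputable def dualLatticeEquiv : (BasisIndex Γ → ℤ) ≃ dualLattice Γ :=
  Equiv.ofBijective
    (fun k => ⟨(dualCoordEquiv Γ).symm (intVec k), dualCoordEquiv_symm_mem Γ k⟩) <| by
    constructor
    · intro k l h
      have h' := (dualCoordEquiv Γ).symm.injective (Subtype.ext_iff.1 h)
      ext i
      simpa [intVec] using congrFun h' i
    · rintro ⟨z, hz⟩
      have h : ∀ i, ∃ k : ℤ, dualCoordEquiv Γ z i = k := fun i =>
        mem_dualLattice.1 hz _ (latticeBasis Γ i).2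
      choose k hk using h
      refine ⟨k, Subtype.ext ?_⟩
      change (dualCoordEquiv Γ).symm (intVec k) = z
      rw [ContinuousLinearEquiv.symm_apply_eq]
      exact (funext hk).symm

/-- Invertible linear changes of variable preserve polynomial decay up to a constant, here a power
of one plus the operator norm. -/
theorem exists_wt_dualCoordEquiv_symm_le (r : ℕ) :
    ∃ M, 0 ≤ M ∧ ∀ x, wt r ((dualCoordEquiv Γ).symm x) ≤ M * wt r x := by
  set M := 1 + ‖(dualCoordEquiv Γ : (Euc n × Euc m) →L[ℝ] (BasisIndex Γ → ℝ))‖ with hM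
  have hM1 : 1 ≤ M := le_add_of_nonneg_right (ContinuousLinearMap.opNorm_nonneg _)
  refine ⟨M ^ r, by positivity, fun x => ?_⟩
  unfold wt
  rw [inv_eq_one_div, div_le_iff₀ (by positivity), mul_right_comm, ← mul_pow,
    ← div_eq_mul_inv, one_le_div (by positivity)]
  gcongr
  have h := (dualCoordEquiv Γ : (Euc n × Euc m) →L[ℝ] (BasisIndex Γ → ℝ)).le_opNorm
    ((dualCoordEquiv Γ).symm x)
  simp only [ContinuousLinearEquiv.coe_coe, ContinuousLinearEquiv.apply_symm_apply] at h
  have h0 := norm_nonneg ((dualCoordEquiv Γ).symm x)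
  nlinarith

theorem summable_wt_mul_wt_dualLattice {r : ℕ} (hr : n + m < r) :
    Summable fun y : dualLattice Γ => wt r (y : Euc n × Euc m).1 * wt r (y : Euc n × Euc m).2 := by
  rw [← (dualLatticeEquiv Γ).summable_iff]
  obtain ⟨M, hM, hle⟩ := exists_wt_dualCoordEquiv_symm_le Γ r
  refine Summable.of_nonneg_of_le (fun k => ?_) (fun k => ?_)
    ((summable_wt_intVec (r := r) (ι := BasisIndex Γ) (by rwa [card_basisIndex])).mul_left M)
  · exact mul_nonneg (wt_pos _ _).le (wt_pos _ _).le
  · exact (norm_mul_wt_le r _).trans (hle _)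

theorem summable_wt_mul_wt {r : ℕ} (hr : n + m < r) :
    Summable fun y : Γ => wt r (y : Euc n × Euc m).1 * wt r (y : Euc n × Euc m).2 := by
  refine Summable.of_nonneg_of_le (fun k => ?_) (fun k => norm_mul_wt_le r _)
    (summable_wt Γ (r := r) (by simpa using hr))
  exact mul_nonneg (wt_pos _ _).le (wt_pos _ _).le

theorem Decays.norm_mul_le {r : ℕ} {E F : Type*} [NormedAddCommGroup E] [NormedAddCommGroup F]
    {K : E → ℂ} {w : F → ℂ} (hK : Decays r K) (hw : Decays r w) :
    ∃ C, 0 ≤ C ∧ ∀ x y, ‖K x * w y‖ ≤ C * (wt r x * wt r y) := by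
  obtain ⟨_, C, hC, h⟩ := hK
  obtain ⟨_, D, hD, h'⟩ := hw
  refine ⟨C * D, by positivity, fun x y => ?_⟩
  rw [norm_mul, mul_mul_mul_comm]
  exact mul_le_mul (h x) (h' y) (norm_nonneg _) ((norm_nonneg _).trans (h x))

theorem Decays.summable_dualLattice {r : ℕ} (hr : n + m < r) {K : Euc n → ℂ} {w : Euc m → ℂ}
    (hK : Decays r K) (hw : Decays r w) :
    Summable fun y : dualLattice Γ => K (y : Euc n × Euc m).1 * w (y : Euc n × Euc m).2 := by
  obtain ⟨C, -, h⟩ := hK.norm_mul_le hw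
  exact Summable.of_norm_bounded ((summable_wt_mul_wt_dualLattice Γ hr).mul_left C) fun y => h _ _

theorem Decays.summable_lattice {r : ℕ} (hr : n + m < r) {K : Euc n → ℂ} {w : Euc m → ℂ}
    (hK : Decays r K) (hw : Decays r w) :
    Summable fun y : Γ => K (y : Euc n × Euc m).1 * w (y : Euc n × Euc m).2 := by
  obtain ⟨C, -, h⟩ := hK.norm_mul_le hw
  exact Summable.of_norm_bounded ((summable_wt_mul_wt Γ hr).mul_left C) fun y => h _ _

/-- The volume of a fundamental domain of the lattice, as a factor of proportionality. -/
theorem exists_integral_dualCoordEquiv_symm :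
    ∃ c : ℝ, 0 < c ∧ ∀ g : Euc n × Euc m → ℂ, ∫ x, g ((dualCoordEquiv Γ).symm x) = c * ∫ z, g z := by
  have : (volume : Measure (Euc n × Euc m)).IsAddHaarMeasure :=
    Measure.prod.instIsAddHaarMeasure _ _
  have := (dualCoordEquiv Γ).symm.isAddHaarMeasure_map volume
  set μ := Measure.map (dualCoordEquiv Γ).symm (volume : Measure (BasisIndex Γ → ℝ)) with hμ
  refine ⟨μ.addHaarScalarFactor volume, ?_, fun g => ?_⟩
  · exact NNReal.coe_pos.2 (Measure.addHaarScalarFactor_pos_of_isAddHaarMeasure μ volume)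
  · have h1 : ∫ x, g ((dualCoordEquiv Γ).symm x) = ∫ z, g z ∂μ := by
      exact ((dualCoordEquiv Γ).symm.toHomeomorph.measurableEmbedding.integral_map g).symm
    rw [h1]
    conv_lhs => rw [Measure.isAddLeftInvariant_eq_smul μ volume]
    rw [integral_smul_nnreal_measure]
    rfl

theorem integral_exp_pairing (K : Euc n → ℂ) (w : Euc m → ℂ) (y : Euc n × Euc m) :
    ∫ z : Euc n × Euc m, Complex.exp (2 * Real.pi * Complex.I * ((-pairing y z : ℝ) : ℂ)) *
      (K z.1 * w z.2) = 𝓕 K y.1 * 𝓕 w y.2 := by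
  rw [Real.fourier_eq', Real.fourier_eq', ← integral_prod_mul]
  refine integral_congr_ae (ae_of_all _ fun z => ?_)
  simp only [smul_eq_mul]
  rw [mul_mul_mul_comm, ← Complex.exp_add]
  congr 2
  simp only [pairing, real_inner_comm]
  push_cast
  ring

/-- Poisson summation for a lattice in a product of Euclidean spaces and products of functions. -/
theorem exists_poisson : ∃ c : ℝ, 0 < c ∧ ∀ (r : ℕ) (K : Euc n → ℂ) (w : Euc m → ℂ), n + m < r →
    Decays r K → Decays r w → Decays r (𝓕 K) → Decays r (𝓕 w) →
    ∑' y : dualLattice Γ, K (y : Euc n × Euc m).1 * w (y : Euc n × Euc m).2 =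
      c * ∑' x : Γ, 𝓕 K (x : Euc n × Euc m).1 * 𝓕 w (x : Euc n × Euc m).2 := by
  obtain ⟨c, hc, hint⟩ := exists_integral_dualCoordEquiv_symm Γ
  refine ⟨c, hc, fun r K w hr hK hw hK' hw' => ?_⟩
  obtain ⟨C, hC, hle⟩ := hK.norm_mul_le hw
  obtain ⟨M, hM, hM'⟩ := exists_wt_dualCoordEquiv_symm_le Γ r
  -- In dual coordinates Γ* becomes the integer lattice, and the integer frequency l becomes the
  -- point of Γ with basis coordinates l.
  have hcoef (l : BasisIndex Γ → ℤ) :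
      (∫ x : BasisIndex Γ → ℝ, Complex.exp (2 * Real.pi * Complex.I *
        ((-∑ i, (l i : ℝ) * x i : ℝ) : ℂ)) *
        (K ((dualCoordEquiv Γ).symm x).1 * w ((dualCoordEquiv Γ).symm x).2)) =
      c * (𝓕 K ((latticeBasis Γ).equivFun.symm l : Euc n × Euc m).1 *
        𝓕 w ((latticeBasis Γ).equivFun.symm l : Euc n × Euc m).2) := by
    rw [← integral_exp_pairing, ← hint]
    refine integral_congr_ae (ae_of_all _ fun x => ?_)
    simp only [pairing_basis_sum, ContinuousLinearEquiv.apply_symm_apply]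
  have hsum := (hK'.summable_lattice Γ hr hw').mul_left (c : ℂ)
  rw [← (latticeBasis Γ).equivFun.symm.toEquiv.summable_iff] at hsum
  rw [← tsum_mul_left, ← (latticeBasis Γ).equivFun.symm.toEquiv.tsum_eq,
    ← (dualLatticeEquiv Γ).tsum_eq]
  have key := tsum_intVec_eq_tsum_integral (r := r) (C := C * M) (F := fun x : BasisIndex Γ → ℝ =>
    K ((dualCoordEquiv Γ).symm x).1 * w ((dualCoordEquiv Γ).symm x).2) (by rwa [card_basisIndex])
    ?_ (by positivity) ?_ ?_
  · rw [funext hcoef] at key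
    exact key
  · have h1 := hK.1
    have h2 := hw.1
    fun_prop
  · intro x
    refine (hle _ _).trans ?_
    rw [mul_assoc]
    exact mul_le_mul_of_nonneg_left ((norm_mul_wt_le r _).trans (hM' x)) hC
  · rw [funext hcoef]
    exact hsum

end LatticePoisson

/-! ### Frames, Riesz sequences and Riesz bases in Hilbert space. -/

section HilbertSystems

variable {ι : Type*} {H : Type*} [NormedAddCommGroup H] [InnerProductSpace ℂ H]

/-- An upper bound for synthesis gives one for analysis. With the coefficients ⟨f_i, x⟩ themselves,
Cauchy–Schwarz yields S² ≤ B S ‖x‖², where S is the sum to be bounded. -/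
theorem sum_norm_inner_sq_le_of_bessel {f : ι → H} {B : ℝ} (hB : 0 ≤ B) {s : Finset ι}
    (h : ∀ c : ι → ℂ, ‖∑ i ∈ s, c i • f i‖ ^ 2 ≤ B * ∑ i ∈ s, ‖c i‖ ^ 2) (x : H) :
    ∑ i ∈ s, ‖(inner ℂ (f i) x : ℂ)‖ ^ 2 ≤ B * ‖x‖ ^ 2 := by
  set S := ∑ i ∈ s, ‖(inner ℂ (f i) x : ℂ)‖ ^ 2 with hS
  have hS0 : 0 ≤ S := Finset.sum_nonneg fun _ _ => by positivity
  have h1 : inner ℂ (∑ i ∈ s, (inner ℂ (f i) x : ℂ) • f i) x = (S : ℂ) := by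
    rw [sum_inner, hS]
    push_cast
    refine Finset.sum_congr rfl fun i _ => ?_
    rw [inner_smul_left, Complex.conj_mul']
  have h2 : S ≤ ‖∑ i ∈ s, (inner ℂ (f i) x : ℂ) • f i‖ * ‖x‖ := by
    have := norm_inner_le_norm (𝕜 := ℂ) (∑ i ∈ s, (inner ℂ (f i) x : ℂ) • f i) x
    rw [h1] at this
    simpa [abs_of_nonneg hS0] using this
  have h3 : S ^ 2 ≤ B * S * ‖x‖ ^ 2 := by
    calc S ^ 2 ≤ (‖∑ i ∈ s, (inner ℂ (f i) x : ℂ) • f i‖ * ‖x‖) ^ 2 := by gcongr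
      _ = ‖∑ i ∈ s, (inner ℂ (f i) x : ℂ) • f i‖ ^ 2 * ‖x‖ ^ 2 := by ring
      _ ≤ _ := by gcongr; exact h _
  rcases hS0.eq_or_lt with h0 | h0
  · rw [← h0]; positivity
  · nlinarith

theorem lp_two_norm_sq (a : lp (fun _ : ι => ℂ) 2) : ‖a‖ ^ 2 = ∑' i, ‖a i‖ ^ 2 := by
  have h := lp.norm_rpow_eq_tsum (p := 2) (by norm_num) a
  simpa using h

theorem memlp_two_iff {a : ι → ℂ} : Memℓp a 2 ↔ Summable fun i => ‖a i‖ ^ 2 := by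
  rw [memℓp_gen_iff (by norm_num)]
  simp

/-- The analysis operator of a Bessel system. -/
theorem exists_analysis {f : ι → H} {B : ℝ} (hB : 0 ≤ B)
    (h : ∀ (s : Finset ι) (x : H), ∑ i ∈ s, ‖(inner ℂ (f i) x : ℂ)‖ ^ 2 ≤ B * ‖x‖ ^ 2) :
    ∃ T : H →L[ℂ] lp (fun _ : ι => ℂ) 2, ∀ x i, T x i = inner ℂ (f i) x := by
  have hs (x : H) : Summable fun i => ‖(inner ℂ (f i) x : ℂ)‖ ^ 2 :=
    summable_of_sum_le (fun _ => by positivity) fun s => h s x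
  let T₀ : H →ₗ[ℂ] lp (fun _ : ι => ℂ) 2 :=
    { toFun := fun x => ⟨fun i => inner ℂ (f i) x, memlp_two_iff.2 (hs x)⟩
      map_add' := fun x y => by ext i; exact inner_add_right _ _ _
      map_smul' := fun c x => by ext i; exact inner_smul_right _ _ _ }
  refine ⟨T₀.mkContinuous √B fun x => ?_, fun x i => rfl⟩
  have h2 : ‖T₀ x‖ ^ 2 ≤ B * ‖x‖ ^ 2 := by
    rw [lp_two_norm_sq]
    exact (hs x).tsum_le_of_sum_le fun s => h s x
  refine le_of_sq_le_sq ?_ (by positivity)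
  rwa [mul_pow, Real.sq_sqrt hB]

/-- The frame inequalities need only be checked on a dense set. -/
theorem IsFrame.of_dense {f : ι → H} {D : Set H} (hD : Dense D) {A B : ℝ} (hA : 0 < A) (hB : 0 < B)
    (h : ∀ x ∈ D, Summable (fun i => ‖(inner ℂ (f i) x : ℂ)‖ ^ 2) ∧
      A * ‖x‖ ^ 2 ≤ ∑' i, ‖(inner ℂ (f i) x : ℂ)‖ ^ 2 ∧
      ∑' i, ‖(inner ℂ (f i) x : ℂ)‖ ^ 2 ≤ B * ‖x‖ ^ 2) : IsFrame f := by
  have hfin (s : Finset ι) (x : H) : ∑ i ∈ s, ‖(inner ℂ (f i) x : ℂ)‖ ^ 2 ≤ B * ‖x‖ ^ 2 := by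
    refine hD.induction (P := fun x => ∑ i ∈ s, ‖(inner ℂ (f i) x : ℂ)‖ ^ 2 ≤ B * ‖x‖ ^ 2)
      (fun x hx => ?_) (isClosed_le (by fun_prop) (by fun_prop)) x
    exact ((h x hx).1.sum_le_tsum s fun _ _ => by positivity).trans (h x hx).2.2
  obtain ⟨T, hT⟩ := exists_analysis hB.le hfin
  have hTn (x : H) : ‖T x‖ ^ 2 = ∑' i, ‖(inner ℂ (f i) x : ℂ)‖ ^ 2 := by
    simp only [lp_two_norm_sq, hT]
  have hs (x : H) : Summable fun i => ‖(inner ℂ (f i) x : ℂ)‖ ^ 2 :=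
    summable_of_sum_le (fun _ => by positivity) fun s => hfin s x
  refine ⟨A, B, hA, hB, fun x => ⟨hs x, ?_, (hs x).tsum_le_of_sum_le fun s => hfin s x⟩⟩
  rw [← hTn]
  refine hD.induction (P := fun x => A * ‖x‖ ^ 2 ≤ ‖T x‖ ^ 2) (fun x hx => ?_)
    (isClosed_le (by fun_prop) (by fun_prop)) x
  rw [hTn]
  exact (h x hx).2.1

/-- Uniqueness forces the expansion of a finite sum to have the given coefficients, so the bounds
apply with A and B inverted and exchanged. -/
theorem IsRieszBasis.isRieszSequence {f : ι → H} (h : IsRieszBasis f) : IsRieszSequence f := by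
  classical
  obtain ⟨A, B, hA, hB, h⟩ := h
  refine ⟨B⁻¹, A⁻¹, by positivity, by positivity, fun s c => ?_⟩
  obtain ⟨d, -, hu, -, h1, h2⟩ := h (∑ i ∈ s, c i • f i)
  have e1 : ∑ i ∈ s, (if i ∈ s then c i else 0) • f i = ∑ i ∈ s, c i • f i :=
    Finset.sum_congr rfl fun i hi => by rw [if_pos hi]
  have hsum : HasSum (fun i => (if i ∈ s then c i else 0) • f i) (∑ i ∈ s, c i • f i) := by
    rw [← e1]
    exact hasSum_sum_of_ne_finset_zero fun i hi => by simp [hi]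
  have e2 : ∑' i, ‖d i‖ ^ 2 = ∑ i ∈ s, ‖c i‖ ^ 2 := by
    rw [← hu _ hsum, tsum_eq_sum (s := s) fun i hi => by simp [hi]]
    exact Finset.sum_congr rfl fun i hi => by simp [hi]
  rw [e2] at h1 h2
  rw [inv_mul_le_iff₀ hB, le_inv_mul_iff₀ hA]
  exact ⟨h2, h1⟩

/-- For the lower bound, expand one entry of ⟨x, x⟩ and apply Cauchy–Schwarz: ‖x‖⁴ ≤ ∑|c_i|² ·
∑|⟨f_i, x⟩|², where the first factor is at most B‖x‖². -/
theorem IsRieszBasis.isFrame {f : ι → H} (h : IsRieszBasis f) : IsFrame f := by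
  obtain ⟨A', B', hA', hB', hRS⟩ := h.isRieszSequence
  obtain ⟨A, B, hA, hB, h⟩ := h
  have hfin (s : Finset ι) (x : H) : ∑ i ∈ s, ‖(inner ℂ (f i) x : ℂ)‖ ^ 2 ≤ B' * ‖x‖ ^ 2 :=
    sum_norm_inner_sq_le_of_bessel hB'.le (fun c => (hRS s c).2) x
  have hs (x : H) : Summable fun i => ‖(inner ℂ (f i) x : ℂ)‖ ^ 2 :=
    summable_of_sum_le (fun _ => by positivity) fun s => hfin s x
  refine ⟨B⁻¹, B', by positivity, hB', fun x => ⟨hs x, ?_, (hs x).tsum_le_of_sum_le fun s => hfin s x⟩⟩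
  obtain ⟨c, hc, -, hcs, -, hle⟩ := h x
  rw [inv_mul_le_iff₀ hB]
  set S := ∑' i, ‖(inner ℂ (f i) x : ℂ)‖ ^ 2 with hS
  have hS0 : 0 ≤ S := tsum_nonneg fun _ => by positivity
  have hlim : Tendsto (fun s : Finset ι => ‖inner ℂ (∑ i ∈ s, c i • f i) x‖ ^ 2) atTop
      (𝓝 (‖(inner ℂ x x : ℂ)‖ ^ 2)) :=
    ((Filter.Tendsto.inner hc tendsto_const_nhds).norm).pow 2
  have hbd : ‖(inner ℂ x x : ℂ)‖ ^ 2 ≤ (B * ‖x‖ ^ 2) * S := by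
    refine le_of_tendsto' hlim fun s => ?_
    calc ‖inner ℂ (∑ i ∈ s, c i • f i) x‖ ^ 2
        ≤ (∑ i ∈ s, ‖c i‖ * ‖(inner ℂ (f i) x : ℂ)‖) ^ 2 := by
          gcongr
          rw [sum_inner]
          refine (norm_sum_le _ _).trans (le_of_eq (Finset.sum_congr rfl fun i _ => ?_))
          rw [inner_smul_left, norm_mul, RCLike.norm_conj]
      _ ≤ (∑ i ∈ s, ‖c i‖ ^ 2) * ∑ i ∈ s, ‖(inner ℂ (f i) x : ℂ)‖ ^ 2 :=
          Finset.sum_mul_sq_le_sq_mul_sq _ _ _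
      _ ≤ _ := by
          gcongr
          · exact (hcs.sum_le_tsum s fun _ _ => by positivity).trans hle
          · exact (hs x).sum_le_tsum s fun _ _ => by positivity
  rw [inner_self_eq_norm_sq_to_K, norm_pow, RCLike.norm_ofReal, abs_norm] at hbd
  rcases eq_or_ne x 0 with rfl | hx
  · simpa using by positivity
  · have : 0 < ‖x‖ ^ 2 := by positivity
    nlinarith

/-- The synthesis operator S, adjoint of analysis, is bounded below by the Riesz property, hence has
closed range. A vector orthogonal to that range has zero frame coefficients, hence vanishes, so S is
onto. -/
theorem IsRieszSequence.isRieszBasis [CompleteSpace H] {f : ι → H} (h : IsRieszSequence f)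
    (hf : IsFrame f) : IsRieszBasis f := by
  classical
  obtain ⟨A, B, hA, hB, hRS⟩ := h
  have hfin (s : Finset ι) (x : H) : ∑ i ∈ s, ‖(inner ℂ (f i) x : ℂ)‖ ^ 2 ≤ B * ‖x‖ ^ 2 :=
    sum_norm_inner_sq_le_of_bessel hB.le (fun c => (hRS s c).2) x
  obtain ⟨T, hT⟩ := exists_analysis hB.le hfin
  set S := ContinuousLinearMap.adjoint T with hS
  have hsingle (i : ι) (c : ℂ) : S (lp.single 2 i c) = c • f i := by
    refine ext_inner_right ℂ fun y => ?_
    rw [hS, ContinuousLinearMap.adjoint_inner_left, lp.inner_single_left, hT, inner_smul_left]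
    simp [mul_comm]
  have hsum (a : lp (fun _ : ι => ℂ) 2) : HasSum (fun i => a i • f i) (S a) := by
    have := S.hasSum (lp.hasSum_single (p := 2) (by norm_num) a)
    simpa only [Function.comp_def, hsingle] using this
  have hbd (a : lp (fun _ : ι => ℂ) 2) : A * ‖a‖ ^ 2 ≤ ‖S a‖ ^ 2 ∧ ‖S a‖ ^ 2 ≤ B * ‖a‖ ^ 2 := by
    have hsq : HasSum (fun i => ‖a i‖ ^ 2) (‖a‖ ^ 2) := by
      rw [lp_two_norm_sq]
      exact (memlp_two_iff.1 (lp.memℓp a)).hasSum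
    have hn : Tendsto (fun s : Finset ι => ‖∑ i ∈ s, a i • f i‖ ^ 2) atTop (𝓝 (‖S a‖ ^ 2)) :=
      (Filter.Tendsto.norm (hsum a)).pow 2
    exact ⟨le_of_tendsto_of_tendsto' (Tendsto.const_mul A hsq) hn fun s => (hRS s a).1,
      le_of_tendsto_of_tendsto' hn (Tendsto.const_mul B hsq) fun s => (hRS s a).2⟩
  have hanti : ∃ K, AntilipschitzWith K S := by
    refine ⟨⟨(√A)⁻¹, by positivity⟩, ContinuousLinearMap.antilipschitz_of_bound S fun a => ?_⟩
    change ‖a‖ ≤ (√A)⁻¹ * ‖S a‖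
    rw [le_inv_mul_iff₀ (Real.sqrt_pos.2 hA)]
    refine le_of_sq_le_sq ?_ (norm_nonneg _)
    rw [mul_pow, Real.sq_sqrt hA.le]
    exact (hbd a).1
  obtain ⟨K, hK⟩ := hanti
  have hclosed : IsClosed (Set.range S) := hK.isClosed_range S.uniformContinuous
  have hsurj : Function.Surjective S := by
    have hker : S.rangeᗮ = ⊥ := by
      rw [eq_bot_iff]
      intro x hx
      obtain ⟨A', B', hA', hB', hf⟩ := hf
      have h0 (i : ι) : (inner ℂ (f i) x : ℂ) = 0 := by
        have := (Submodule.mem_orthogonal _ _).1 hx (S (lp.single 2 i 1)) ⟨_, rfl⟩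
        simpa [hsingle] using this
      have h1 := (hf x).2.1
      simp only [h0, norm_zero, ne_eq, OfNat.ofNat_ne_zero, not_false_eq_true, zero_pow,
        tsum_zero] at h1
      have h2 : ‖x‖ ^ 2 ≤ 0 := by
        by_contra hx
        push Not at hx
        exact absurd h1 (not_le.2 (mul_pos hA' hx))
      simpa using h2
    have : S.range.topologicalClosure = ⊤ := Submodule.topologicalClosure_eq_top_iff.2 hker
    rw [IsClosed.submodule_topologicalClosure_eq (s := S.range) hclosed] at this
    exact LinearMap.range_eq_top.1 this
  refine ⟨B⁻¹, A⁻¹, by positivity, by positivity, fun x => ?_⟩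
  obtain ⟨a, rfl⟩ := hsurj x
  refine ⟨a, hsum a, fun c' hc' => ?_, memlp_two_iff.1 (lp.memℓp a), ?_, ?_⟩
  · have hd : HasSum (fun i => (c' i - a i) • f i) 0 := by
      simpa only [sub_smul, sub_self] using hc'.sub (hsum a)
    have hn : Tendsto (fun s : Finset ι => ‖∑ i ∈ s, (c' i - a i) • f i‖ ^ 2) atTop (𝓝 0) := by
      simpa using (Filter.Tendsto.norm hd).pow 2
    funext i
    -- Finite partial sums of the difference tend to 0 in norm, while the lower Riesz bound keeps
    -- each one containing i above this term.
    have hi : A * ‖c' i - a i‖ ^ 2 ≤ 0 := by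
      refine ge_of_tendsto hn ?_
      filter_upwards [eventually_ge_atTop {i}] with s hs
      refine le_trans ?_ (hRS s fun i => c' i - a i).1
      gcongr
      exact Finset.single_le_sum (f := fun i => ‖c' i - a i‖ ^ 2) (fun _ _ => by positivity)
        (Finset.singleton_subset_iff.1 hs)
    have h2 : ‖c' i - a i‖ ^ 2 ≤ 0 := by
      by_contra hx
      push Not at hx
      exact absurd hi (not_le.2 (mul_pos hA hx))
    have h3 : c' i - a i = 0 := by simpa using h2
    exact sub_eq_zero.1 h3
  · rw [inv_mul_le_iff₀ hB, ← lp_two_norm_sq]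
    exact (hbd a).2
  · rw [le_inv_mul_iff₀ hA, ← lp_two_norm_sq]
    exact (hbd a).1

end HilbertSystems

/-! ### General position of the dual lattice, and equidistribution in strips. -/

section Equidistribution

variable {n m : ℕ}

/-- If (z₁, 0) is in Γ*, then ⟨x, z₁⟩ is an integer for x in the dense set p₁(Γ), hence for every x
because ℤ is closed. Rescaling x excludes z₁ ≠ 0. -/
theorem GeneralPosition.injOn_snd_dualLattice {Γ : Submodule ℤ (Euc n × Euc m)}
    (hΓ : GeneralPosition Γ) :
    Set.InjOn Prod.snd (dualLattice Γ : Set (Euc n × Euc m)) := by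
  intro a ha b hb hab
  have hz : a - b ∈ dualLattice Γ := sub_mem ha hb
  have hz2 : (a - b).2 = 0 := by simpa [sub_eq_zero] using hab
  set z := a - b with hzdef
  have hz1 : z.1 = 0 := by
    by_contra hne
    have hcl : IsClosed {x : Euc n | ∃ k : ℤ, (inner ℝ x z.1 : ℝ) = k} := by
      have h : {x : Euc n | ∃ k : ℤ, (inner ℝ x z.1 : ℝ) = k} =
          (fun x : Euc n => (inner ℝ x z.1 : ℝ)) ⁻¹' Set.range ((↑) : ℤ → ℝ) := by
        ext x; simp [eq_comm]
      rw [h]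
      exact Int.isClosedEmbedding_coe_real.isClosed_range.preimage (by fun_prop)
    have hall := hΓ.dense_fst.induction (P := fun x => ∃ k : ℤ, (inner ℝ x z.1 : ℝ) = k)
      (by
        rintro _ ⟨x, hx, rfl⟩
        obtain ⟨k, hk⟩ := hz x hx
        exact ⟨k, by simpa [hz2] using hk⟩) hcl
    -- This multiple of z₁ has inner product 1/2 with z₁.
    obtain ⟨k, hk⟩ := hall ((1 / (2 * ‖z.1‖ ^ 2)) • z.1)
    have hn : ‖z.1‖ ^ 2 ≠ 0 := by positivity
    rw [real_inner_smul_left, real_inner_self_eq_norm_sq] at hk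
    have h2 : (2 * k : ℝ) = 1 := by
      rw [← hk]; field_simp
    have h3 : 2 * k = 1 := by exact_mod_cast h2
    omega
  have : z = 0 := Prod.ext hz1 hz2
  rwa [hzdef, sub_eq_zero] at this

theorem decays_schwartz {E : Type*} [NormedAddCommGroup E] [NormedSpace ℝ E] (r : ℕ)
    (f : 𝓢(E, ℂ)) : Decays r f := by
  refine ⟨f.continuous, 2 ^ r * ((Finset.Iic (r, 0)).sup fun m : ℕ × ℕ =>
    SchwartzMap.seminorm ℝ m.1 m.2) f, by positivity, fun x => ?_⟩
  have h := SchwartzMap.one_add_le_sup_seminorm_apply (𝕜 := ℝ) (m := (r, 0)) le_rfl le_rfl f x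
  rw [norm_iteratedFDeriv_zero] at h
  rw [wt, ← div_eq_mul_inv, le_div_iff₀ (by positivity), mul_comm]
  exact h

theorem decays_fourier_schwartz {k : ℕ} (r : ℕ) (f : 𝓢(Euc k, ℂ)) :
    Decays r (𝓕 (f : Euc k → ℂ)) := by
  rw [← SchwartzMap.fourier_coe]
  exact decays_schwartz r (𝓕 f)

theorem wt_smul_le {E : Type*} [NormedAddCommGroup E] [NormedSpace ℝ E] (r : ℕ) {a : ℝ}
    (ha : 0 < a) (x : E) : wt r (a • x) ≤ (1 + a⁻¹) ^ r * wt r x := by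
  unfold wt
  rw [inv_eq_one_div, div_le_iff₀ (by positivity), mul_right_comm, ← mul_pow,
    ← div_eq_mul_inv, one_le_div (by positivity)]
  gcongr
  rw [norm_smul, Real.norm_of_nonneg ha.le]
  have h1 : (1 + a⁻¹) * (1 + a * ‖x‖) = 1 + ‖x‖ + a * ‖x‖ + a⁻¹ := by
    field_simp; ring
  rw [h1]
  have : 0 < a⁻¹ := by positivity
  nlinarith [norm_nonneg x]

/-- Decay is preserved by affine substitutions and bounded continuous factors. -/
theorem Decays.comp_affine {E : Type*} [NormedAddCommGroup E] [NormedSpace ℝ E] {r : ℕ}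
    {w : E → ℂ} (hw : Decays r w) {a : ℝ} (ha : 0 < a) (v : E) {e : E → ℂ} (he : Continuous e)
    {D : ℝ} (hD : ∀ x, ‖e x‖ ≤ D) : Decays r fun x => e x * w (v + a • x) := by
  obtain ⟨hc, C, hC, h⟩ := hw
  have hD0 : 0 ≤ D := (norm_nonneg _).trans (hD 0)
  refine ⟨by fun_prop, D * (C * ((1 + ‖v‖) ^ r * (1 + a⁻¹) ^ r)), by positivity, fun x => ?_⟩
  rw [norm_mul, mul_assoc]
  refine mul_le_mul (hD x) ?_ (norm_nonneg _) hD0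
  refine (h _).trans ?_
  rw [mul_assoc]
  refine mul_le_mul_of_nonneg_left ?_ hC
  rw [mul_assoc]
  exact (wt_add_le r _ _).trans (mul_le_mul_of_nonneg_left (wt_smul_le r ha x) (by positivity))

/-- Modulation becomes translation and dilation is inverted. The term `0 +` keeps the affine form
expected by `Decays.comp_affine`. -/
theorem fourier_expFun_mul_comp_smul (w : Euc m → ℂ) {ε : ℝ} (hε : 0 < ε) (y ξ : Euc m) :
    𝓕 (fun z => expFun y z * w (0 + ε • z)) ξ =
      ((ε ^ m)⁻¹ : ℝ) * 𝓕 w (-(ε⁻¹ • y) + ε⁻¹ • ξ) := by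
  rw [Real.fourier_eq', Real.fourier_eq']
  have h := Measure.integral_comp_smul (volume : Measure (Euc m)) (fun v : Euc m =>
    Complex.exp (↑(-2 * Real.pi * inner ℝ v (-(ε⁻¹ • y) + ε⁻¹ • ξ)) * Complex.I) • w v) ε
  rw [finrank_euclideanSpace_fin, abs_of_pos (by positivity), Complex.real_smul] at h
  rw [← h]
  refine integral_congr_ae (ae_of_all _ fun v => ?_)
  simp only [smul_eq_mul, zero_add, expFun]
  rw [← mul_assoc, ← Complex.exp_add]
  congr 2
  simp only [inner_add_right, inner_neg_right, real_inner_smul_left, real_inner_smul_right]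
  rw [inv_mul_cancel_left₀ hε.ne', inv_mul_cancel_left₀ hε.ne', real_inner_comm y v]
  push_cast
  ring

variable (Γ : Submodule ℤ (Euc n × Euc m)) [DiscreteTopology Γ] [IsZLattice ℝ Γ]

/-- The constant of Poisson summation for the lattice. -/
noncomputable def poissonConst : ℝ := (exists_poisson Γ).choose

theorem poissonConst_pos : 0 < poissonConst Γ := (exists_poisson Γ).choose_spec.1

/-- Poisson summation with a dilated and modulated second factor. -/
theorem poisson_modulated (K : 𝓢(Euc n, ℂ)) (w : 𝓢(Euc m, ℂ)) {ε : ℝ} (hε : 0 < ε) (y : Euc m) :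
    ∑' x : dualLattice Γ, K (x : Euc n × Euc m).1 *
        (expFun y (x : Euc n × Euc m).2 * w (ε • (x : Euc n × Euc m).2)) =
      poissonConst Γ * ((ε ^ m)⁻¹ : ℝ) * ∑' x : Γ, 𝓕 (K : Euc n → ℂ) (x : Euc n × Euc m).1 *
        𝓕 (w : Euc m → ℂ) (-(ε⁻¹ • y) + ε⁻¹ • (x : Euc n × Euc m).2) := by
  have h := (exists_poisson Γ).choose_spec.2 (n + m + 1) K
    (fun z => expFun y z * w (0 + ε • z)) (by omega) (decays_schwartz _ K)
    ((decays_schwartz _ w).comp_affine hε 0 (continuous_expFun y) fun x => (norm_expFun y x).le)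
    (decays_fourier_schwartz _ K) ?_
  · simp only [fourier_expFun_mul_comp_smul (w : Euc m → ℂ) hε] at h
    simp only [zero_add] at h
    rw [h, mul_assoc, ← tsum_mul_left (a := (((ε ^ m)⁻¹ : ℝ) : ℂ))]
    simp only [poissonConst]
    congr 1
    exact tsum_congr fun x => mul_left_comm _ _ _
  · rw [funext (fourier_expFun_mul_comp_smul (w : Euc m → ℂ) hε y)]
    exact (decays_fourier_schwartz _ w).comp_affine (inv_pos.2 hε) _
      (continuous_const (y := (((ε ^ m)⁻¹ : ℝ) : ℂ))) fun _ => le_rfl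

theorem summable_schwartz_dualLattice (K : 𝓢(Euc n, ℂ)) (w : 𝓢(Euc m, ℂ)) {ε : ℝ} (hε : 0 < ε) :
    Summable fun x : dualLattice Γ => K (x : Euc n × Euc m).1 * w (ε • (x : Euc n × Euc m).2) := by
  have h := (decays_schwartz (n + m + 1) K).summable_dualLattice Γ (by omega)
    ((decays_schwartz (n + m + 1) w).comp_affine hε 0 (continuous_const (y := (1 : ℂ)))
      fun _ => le_rfl)
  simpa using h

/-- Equidistribution of the dual lattice points in long strips. -/
theorem tendsto_tsum_dualLattice (hΓ : Set.InjOn Prod.snd (Γ : Set (Euc n × Euc m)))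
    (K : 𝓢(Euc n, ℂ)) (w : 𝓢(Euc m, ℂ)) :
    Tendsto (fun ε : ℝ => ((ε ^ m : ℝ) : ℂ) * ∑' x : dualLattice Γ,
      K (x : Euc n × Euc m).1 * w (ε • (x : Euc n × Euc m).2)) (𝓝[>] 0)
      (𝓝 (poissonConst Γ * ((∫ x, K x) * ∫ y, w y))) := by
  have hP : ∀ᶠ ε : ℝ in 𝓝[>] 0, (poissonConst Γ : ℂ) * ∑' x : Γ,
      𝓕 (K : Euc n → ℂ) (x : Euc n × Euc m).1 * 𝓕 (w : Euc m → ℂ) (ε⁻¹ • (x : Euc n × Euc m).2) =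
      ((ε ^ m : ℝ) : ℂ) * ∑' x : dualLattice Γ,
        K (x : Euc n × Euc m).1 * w (ε • (x : Euc n × Euc m).2) := by
    filter_upwards [self_mem_nhdsWithin] with ε hε
    have h := poisson_modulated Γ K w hε 0
    simp only [expFun, inner_zero_left, Complex.ofReal_zero, mul_zero, Complex.exp_zero, one_mul,
      smul_zero, neg_zero, zero_add] at h
    rw [h, Complex.ofReal_inv, mul_left_comm, mul_assoc, inv_mul_cancel_left₀]
    exact Complex.ofReal_ne_zero.2 (pow_pos hε m).ne'
  refine Tendsto.congr' hP (Tendsto.const_mul _ ?_)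
  obtain ⟨C, hC, hle⟩ := (decays_fourier_schwartz (n + m + 1) K).norm_mul_le
    (decays_fourier_schwartz (n + m + 1) w)
  -- The limit is written as a series supported at γ = 0. Any other γ has p₂γ ≠ 0 by injectivity, so
  -- ε⁻¹ p₂γ escapes to infinity and its term tends to 0.
  have e : (∫ x, K x) * ∫ y, w y = ∑' x : Γ, if x = 0 then (∫ x, K x) * ∫ y, w y else 0 := by
    rw [tsum_ite_eq]
  rw [e]
  refine tendsto_tsum_of_dominated_convergence
    (f := fun (ε : ℝ) (x : Γ) => 𝓕 (K : Euc n → ℂ) (x : Euc n × Euc m).1 *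
      𝓕 (w : Euc m → ℂ) (ε⁻¹ • (x : Euc n × Euc m).2))
    (g := fun x : Γ => if x = 0 then (∫ x, K x) * ∫ y, w y else 0)
    ((summable_wt_mul_wt Γ (r := n + m + 1) (by omega)).mul_left C) ?_ ?_
  · intro x
    split_ifs with hx
    · subst hx
      refine tendsto_const_nhds.congr fun ε => ?_
      simp [Real.fourier_eq']
    · have hx2 : (x : Euc n × Euc m).2 ≠ 0 := by
        intro h0
        apply hx
        exact Subtype.ext (hΓ x.2 (zero_mem Γ) (by simpa using h0))
      rw [← mul_zero (𝓕 (K : Euc n → ℂ) (x : Euc n × Euc m).1)]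
      refine Tendsto.const_mul _ ?_
      have h1 := (𝓕 w).tendsto_cocompact
      rw [← Metric.cobounded_eq_cocompact] at h1
      refine h1.comp (tendsto_norm_atTop_iff_cobounded.1 ?_)
      simp only [norm_smul]
      exact (tendsto_norm_atTop_atTop.comp tendsto_inv_nhdsGT_zero).atTop_mul_const
        (norm_pos_iff.2 hx2)
  · have h1 : ∀ᶠ ε : ℝ in 𝓝[>] 0, ε ∈ Set.Ioo (0 : ℝ) 1 := Ioo_mem_nhdsGT one_pos
    filter_upwards [h1] with ε hε x
    refine (hle _ _).trans ?_
    gcongr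
    · exact (wt_pos _ _).le
    · apply wt_anti
      rw [norm_smul, norm_inv, Real.norm_of_nonneg hε.1.le]
      exact le_mul_of_one_le_left (norm_nonneg _) ((one_le_inv₀ hε.1).2 hε.2.le)

end Equidistribution

/-! ### Directions of approach to the boundary of V. -/

section Windows

variable {n m : ℕ}

/-- A direction of approach: small balls near each projected lattice point in direction `u` lie
in `V` or outside `V` according to whether the point does. -/
def IsWindow (Γ : Submodule ℤ (Euc n × Euc m)) (V : Set (Euc m)) (u : Euc m) : Prop :=
  ∀ v ∈ Prod.snd '' (Γ : Set (Euc n × Euc m)),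
    (v ∈ V → ∀ᶠ ε : ℝ in 𝓝[>] 0, ∀ w ∈ Metric.ball u (1 / 2), v + ε • w ∈ V) ∧
    (v ∉ V → ∀ᶠ ε : ℝ in 𝓝[>] 0, ∀ w ∈ Metric.ball u (1 / 2), v + ε • w ∉ V)

theorem eventually_add_smul_mem {O : Set (Euc m)} {v : Euc m} (h : O ∈ 𝓝 v) :
    ∀ᶠ ε : ℝ in 𝓝[>] 0, ∀ w ∈ Metric.ball (0 : Euc m) (1 / 2), v + ε • w ∈ O := by
  obtain ⟨δ, hδ, hO⟩ := Metric.mem_nhds_iff.1 h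
  filter_upwards [Ioo_mem_nhdsGT hδ] with ε hε w hw
  apply hO
  rw [mem_ball_zero_iff] at hw
  rw [mem_ball_iff_norm, add_sub_cancel_left, norm_smul, Real.norm_of_nonneg hε.1.le]
  nlinarith [hε.1, hε.2, norm_nonneg w]

theorem isWindow_of_frontier {Γ : Submodule ℤ (Euc n × Euc m)} {V : Set (Euc m)}
    (h : frontier V ∩ Prod.snd '' (Γ : Set (Euc n × Euc m)) = ∅) : IsWindow Γ V 0 := by
  intro v hv
  have hf : v ∉ frontier V := fun hv' => by
    have : v ∈ frontier V ∩ Prod.snd '' (Γ : Set (Euc n × Euc m)) := ⟨hv', hv⟩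
    rw [h] at this
    exact this
  refine ⟨fun hvV => eventually_add_smul_mem ?_, fun hvV => ?_⟩
  · rw [← mem_interior_iff_mem_nhds]
    by_contra hi
    exact hf ⟨subset_closure hvV, hi⟩
  · have hc : Vᶜ ∈ 𝓝 v := by
      rw [← mem_interior_iff_mem_nhds, interior_compl]
      intro hcl
      exact hf ⟨hcl, fun hi => hvV (interior_subset hi)⟩
    exact eventually_add_smul_mem hc

/-- For [a, b) bumps are placed just to the right of each point (u = 1/2), for (a, b] just to the
left (u = -1/2). An included endpoint is then approached from inside, an excluded one from outside.
-/
theorem isWindow_of_semiClosed {Γ : Submodule ℤ (Euc n × Euc m)} {V : Set (Euc m)}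
    (h : IsSemiClosedInterval V) : ∃ u, IsWindow Γ V u := by
  obtain ⟨rfl, a, b, hab, h⟩ := h
  have hball {u w : Euc 1} (hw : w ∈ Metric.ball u (1 / 2)) : |w 0 - u 0| < 1 / 2 := by
    rw [mem_ball_iff_norm] at hw
    exact (PiLp.norm_apply_le (w - u) 0).trans_lt hw
  rcases h with rfl | rfl
  · refine ⟨WithLp.toLp 2 fun _ => 1 / 2, fun v _ => ⟨fun hv => ?_, fun hv => ?_⟩⟩
    · simp only [Fin.forall_fin_one, Set.mem_ofPred_eq, Set.mem_Ico] at hv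
      filter_upwards [Ioo_mem_nhdsGT (sub_pos.2 hv.2)] with ε hε w hw
      have h := abs_lt.1 (hball hw)
      simp only [Fin.forall_fin_one, Set.mem_Ico, PiLp.add_apply,
        PiLp.smul_apply, smul_eq_mul] at h ⊢
      constructor <;> nlinarith [hε.1, hε.2]
    · simp only [Fin.forall_fin_one, Set.mem_ofPred_eq, Set.mem_Ico, not_and, not_lt] at hv
      rcases lt_or_ge (v 0) a with hva | hva
      · filter_upwards [Ioo_mem_nhdsGT (sub_pos.2 hva)] with ε hε w hw
        have h := abs_lt.1 (hball hw)
        simp only [Fin.forall_fin_one, Set.mem_Ico, PiLp.add_apply,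
          PiLp.smul_apply, smul_eq_mul] at h ⊢
        rintro ⟨h1, -⟩
        nlinarith [hε.1, hε.2]
      · filter_upwards [self_mem_nhdsWithin] with ε hε w hw
        have hε' : 0 < ε := hε
        have h := abs_lt.1 (hball hw)
        simp only [Fin.forall_fin_one, Set.mem_Ico, PiLp.add_apply,
          PiLp.smul_apply, smul_eq_mul] at h ⊢
        rintro ⟨-, h1⟩
        nlinarith [hv hva]
  · refine ⟨WithLp.toLp 2 fun _ => -(1 / 2), fun v _ => ⟨fun hv => ?_, fun hv => ?_⟩⟩
    · simp only [Fin.forall_fin_one, Set.mem_ofPred_eq, Set.mem_Ioc] at hv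
      filter_upwards [Ioo_mem_nhdsGT (sub_pos.2 hv.1)] with ε hε w hw
      have h := abs_lt.1 (hball hw)
      simp only [Fin.forall_fin_one, Set.mem_Ioc, PiLp.add_apply,
        PiLp.smul_apply, smul_eq_mul] at h ⊢
      constructor <;> nlinarith [hε.1, hε.2]
    · simp only [Fin.forall_fin_one, Set.mem_ofPred_eq, Set.mem_Ioc, not_and, not_le] at hv
      rcases le_or_gt (v 0) a with hva | hva
      · filter_upwards [self_mem_nhdsWithin] with ε hε w hw
        have hε' : 0 < ε := hε
        have h := abs_lt.1 (hball hw)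
        simp only [Fin.forall_fin_one, Set.mem_Ioc, PiLp.add_apply,
          PiLp.smul_apply, smul_eq_mul] at h ⊢
        rintro ⟨h1, -⟩
        nlinarith
      · filter_upwards [Ioo_mem_nhdsGT (sub_pos.2 (hv hva))] with ε hε w hw
        have h := abs_lt.1 (hball hw)
        simp only [Fin.forall_fin_one, Set.mem_Ioc, PiLp.add_apply,
          PiLp.smul_apply, smul_eq_mul] at h ⊢
        rintro ⟨-, h1⟩
        nlinarith [hε.1, hε.2]

/-- A nonzero Schwartz function supported in a given ball of radius `1 / 2`. -/
theorem exists_schwartz_bump (u : Euc m) : ∃ φ : 𝓢(Euc m, ℂ),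
    (∀ x ∉ Metric.ball u (1 / 2), φ x = 0) ∧ 0 < ∫ x, ‖φ x‖ ^ 2 := by
  obtain ⟨b, hb, hcs, hsm, -, hbu⟩ :=
    exists_contDiff_tsupport_subset (n := ⊤) (Metric.ball_mem_nhds u (by norm_num : (0 : ℝ) < 1 / 2))
  have hs : HasCompactSupport fun x => (b x : ℂ) := hcs.comp_left (g := Complex.ofReal) rfl
  have hc : ContDiff ℝ ((⊤ : ℕ∞) : WithTop ℕ∞) fun x => (b x : ℂ) :=
    Complex.ofRealCLM.contDiff.comp hsm
  have hφ (x : Euc m) : hs.toSchwartzMap hc x = (b x : ℂ) := rfl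
  refine ⟨hs.toSchwartzMap hc, fun x hx => ?_, ?_⟩
  · rw [hφ, image_eq_zero_of_notMem_tsupport fun h => hx (hb h), Complex.ofReal_zero]
  · refine Continuous.integral_pos_of_hasCompactSupport_nonneg_nonzero (x := u)
      ((hs.toSchwartzMap hc).continuous.norm.pow 2)
      (hs.comp_left (g := fun z : ℂ => ‖z‖ ^ 2) (by simp)) (fun x => by positivity) ?_
    simp [hφ, hbu]

end Windows

/-! ### Small bumps and their Fourier transforms. -/

section Dilates

variable {m : ℕ}

/-- The dilate of `φ` by `ε`, translated to `v`. -/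
noncomputable def dil (φ : Euc m → ℂ) (ε : ℝ) (v y : Euc m) : ℂ := φ (ε⁻¹ • (y - v))

theorem continuous_dil (φ : 𝓢(Euc m, ℂ)) (ε : ℝ) (v : Euc m) : Continuous (dil φ ε v) := by
  have := φ.continuous
  unfold dil
  fun_prop

theorem integral_comp_dil {G : Type*} [NormedAddCommGroup G] [NormedSpace ℝ G] (g : Euc m → G)
    {ε : ℝ} (hε : 0 < ε) (v : Euc m) : ∫ y, g (ε⁻¹ • (y - v)) = (ε ^ m) • ∫ y, g y := by
  rw [integral_sub_right_eq_self (fun y => g (ε⁻¹ • y)) v, Measure.integral_comp_inv_smul,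
    finrank_euclideanSpace_fin, abs_of_pos (by positivity)]

theorem integral_norm_sq_dil (φ : Euc m → ℂ) {ε : ℝ} (hε : 0 < ε) (v : Euc m) :
    ∫ y, ‖dil φ ε v y‖ ^ 2 = ε ^ m * ∫ y, ‖φ y‖ ^ 2 :=
  integral_comp_dil (fun y => ‖φ y‖ ^ 2) hε v

theorem integrable_dil (φ : 𝓢(Euc m, ℂ)) {ε : ℝ} (hε : 0 < ε) (v : Euc m) :
    Integrable (dil φ ε v) :=
  (φ.integrable.comp_smul (inv_pos.2 hε).ne').comp_sub_right v

theorem conj_expFun (x y : Euc m) : (starRingEnd ℂ) (expFun x y) =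
    Complex.exp (↑(-2 * Real.pi * inner ℝ y x) * Complex.I) := by
  rw [expFun, ← Complex.exp_conj]
  congr 1
  simp only [map_mul, Complex.conj_ofReal, Complex.conj_I, map_ofNat, real_inner_comm]
  push_cast
  ring

theorem expFun_comm (x y : Euc m) : expFun x y = expFun y x := by
  rw [expFun, expFun, real_inner_comm]

theorem expFun_mul_conj (x y : Euc m) : expFun x y * (starRingEnd ℂ) (expFun x y) = 1 := by
  rw [Complex.mul_conj', norm_expFun]; simp

theorem fourier_eq_integral_expFun (f : Euc m → ℂ) (x : Euc m) :
    𝓕 f x = ∫ y, (starRingEnd ℂ) (expFun x y) * f y := by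
  simp only [Real.fourier_eq', conj_expFun, smul_eq_mul]

theorem expFun_add_right (x y z : Euc m) : expFun x (y + z) = expFun x y * expFun x z := by
  rw [expFun, expFun, expFun, ← Complex.exp_add, inner_add_right]
  congr 1
  push_cast
  ring

theorem expFun_smul_right (x y : Euc m) (a : ℝ) : expFun x (a • y) = expFun (a • x) y := by
  rw [expFun, expFun, real_inner_smul_right, real_inner_smul_left]

theorem integral_conj_expFun_mul_dil (φ : Euc m → ℂ) {ε : ℝ} (hε : 0 < ε) (v x : Euc m) :
    ∫ y, (starRingEnd ℂ) (expFun x y) * dil φ ε v y =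
      (starRingEnd ℂ) (expFun x v) * ((ε ^ m : ℝ) * 𝓕 φ (ε • x)) := by
  have h := integral_comp_dil
    (fun z => (starRingEnd ℂ) (expFun x v) * ((starRingEnd ℂ) (expFun (ε • x) z) * φ z)) hε v
  simp only [integral_const_mul] at h
  rw [← fourier_eq_integral_expFun, Complex.real_smul] at h
  rw [mul_left_comm, ← h, ← integral_const_mul]
  refine integral_congr_ae (ae_of_all _ fun y => ?_)
  simp only [dil]
  rw [← mul_assoc, ← expFun_smul_right, smul_inv_smul₀ hε.ne', ← map_mul, ← expFun_add_right,
    add_sub_cancel]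

theorem expFun_mul_expFun_of_mem {n : ℕ} {Γ : Submodule ℤ (Euc n × Euc m)} {x y : Euc n × Euc m}
    (hx : x ∈ Γ) (hy : y ∈ dualLattice Γ) : expFun x.1 y.1 * expFun x.2 y.2 = 1 := by
  obtain ⟨k, hk⟩ := hy x hx
  rw [expFun, expFun, ← Complex.exp_add, ← mul_add, ← Complex.ofReal_add, hk,
    Complex.ofReal_intCast, mul_comm, Complex.exp_int_mul_two_pi_mul_I]

/-- Integrality of ⟨γ, γ*⟩ trades the internal phase at (p₂γ, p₂γ*) for the physical exponential at
(p₁γ, p₁γ*); this exchanges the two model sets. -/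
theorem conj_expFun_of_mem {n : ℕ} {Γ : Submodule ℤ (Euc n × Euc m)} {x y : Euc n × Euc m}
    (hx : x ∈ Γ) (hy : y ∈ dualLattice Γ) :
    (starRingEnd ℂ) (expFun y.2 x.2) = expFun x.1 y.1 := by
  have h1 := expFun_mul_expFun_of_mem hx hy
  have h2 := expFun_mul_conj x.2 y.2
  rw [expFun_comm y.2]
  calc _ = (expFun x.1 y.1 * expFun x.2 y.2) * (starRingEnd ℂ) (expFun x.2 y.2) := by
        rw [h1, one_mul]
    _ = _ := by rw [mul_assoc, h2, mul_one]

variable {u : Euc m} {φ : 𝓢(Euc m, ℂ)}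

theorem exists_of_dil_ne_zero (hφ : ∀ x ∉ Metric.ball u (1 / 2), φ x = 0) {ε : ℝ} (hε : 0 < ε)
    {v y : Euc m} (h : dil φ ε v y ≠ 0) : ∃ w ∈ Metric.ball u (1 / 2), y = v + ε • w := by
  refine ⟨ε⁻¹ • (y - v), by_contra fun hw => h (hφ _ hw), ?_⟩
  rw [smul_inv_smul₀ hε.ne', add_sub_cancel]

/-- Two points of a ball of radius 1/2 are less than 1 apart, so the supports separate as soon as ε
< ‖v - v'‖. -/
theorem eventually_dil_disjoint (hφ : ∀ x ∉ Metric.ball u (1 / 2), φ x = 0) {v v' : Euc m}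
    (hv : v ≠ v') : ∀ᶠ ε : ℝ in 𝓝[>] 0, ∀ y, dil φ ε v y * (starRingEnd ℂ) (dil φ ε v' y) = 0 := by
  filter_upwards [Ioo_mem_nhdsGT (norm_pos_iff.2 (sub_ne_zero.2 hv))] with ε hε y
  by_contra h
  obtain ⟨w, hw, h1⟩ := exists_of_dil_ne_zero hφ hε.1 (left_ne_zero_of_mul h)
  obtain ⟨w', hw', h2⟩ := exists_of_dil_ne_zero hφ hε.1
    (v := v') (y := y) fun h0 => h (by rw [h0]; simp)
  have h3 : v - v' = ε • (w' - w) := by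
    rw [smul_sub, sub_eq_sub_iff_add_eq_add, ← h1, h2, add_comm]
  have h4 : ‖w' - w‖ < 1 := by
    rw [← dist_eq_norm]
    calc dist w' w ≤ dist w' u + dist w u := dist_triangle_right _ _ _
      _ < 1 / 2 + 1 / 2 := add_lt_add hw' hw
      _ = 1 := by norm_num
  have h5 := hε.2
  rw [h3, norm_smul, Real.norm_of_nonneg hε.1.le] at h5
  nlinarith [hε.1]

theorem IsWindow.eventually_dil_mem {n : ℕ} {Γ : Submodule ℤ (Euc n × Euc m)} {V : Set (Euc m)}
    (hu : IsWindow Γ V u) (hφ : ∀ x ∉ Metric.ball u (1 / 2), φ x = 0) {x : Euc n × Euc m}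
    (hx : x ∈ Γ) (hxV : x.2 ∈ V) : ∀ᶠ ε : ℝ in 𝓝[>] 0, ∀ y ∉ V, dil φ ε x.2 y = 0 := by
  filter_upwards [self_mem_nhdsWithin, (hu x.2 ⟨x, hx, rfl⟩).1 hxV] with ε hε h y hy
  by_contra h0
  obtain ⟨w, hw, rfl⟩ := exists_of_dil_ne_zero hφ hε h0
  exact hy (h w hw)

theorem IsWindow.eventually_dil_notMem {n : ℕ} {Γ : Submodule ℤ (Euc n × Euc m)} {V : Set (Euc m)}
    (hu : IsWindow Γ V u) (hφ : ∀ x ∉ Metric.ball u (1 / 2), φ x = 0) {x : Euc n × Euc m}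
    (hx : x ∈ Γ) (hxV : x.2 ∉ V) : ∀ᶠ ε : ℝ in 𝓝[>] 0, ∀ y ∈ V, dil φ ε x.2 y = 0 := by
  filter_upwards [self_mem_nhdsWithin, (hu x.2 ⟨x, hx, rfl⟩).2 hxV] with ε hε h y hy
  by_contra h0
  obtain ⟨w, hw, rfl⟩ := exists_of_dil_ne_zero hφ hε h0
  exact h w hw hy

end Dilates

/-! ### Equidistribution for squared moduli. -/

section Equidistribution

variable {n m : ℕ} (Γ : Submodule ℤ (Euc n × Euc m)) [DiscreteTopology Γ] [IsZLattice ℝ Γ]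

/-- The squared modulus of a Schwartz function. -/
noncomputable def normSqSchwartz {k : ℕ} (f : 𝓢(Euc k, ℂ)) : 𝓢(Euc k, ℂ) :=
  SchwartzMap.pairing (ContinuousLinearMap.mul ℝ ℂ) f
    (SchwartzMap.postcompCLM (𝕜 := ℝ) (Complex.conjCLE : ℂ →L[ℝ] ℂ) f)

theorem normSqSchwartz_apply {k : ℕ} (f : 𝓢(Euc k, ℂ)) (x : Euc k) :
    normSqSchwartz f x = ((‖f x‖ ^ 2 : ℝ) : ℂ) := by
  simp only [normSqSchwartz, SchwartzMap.pairing_apply_apply, SchwartzMap.postcompCLM_apply]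
  simp [Complex.mul_conj']

theorem integrable_norm_sq_schwartz {k : ℕ} (f : 𝓢(Euc k, ℂ)) :
    Integrable fun x => ‖f x‖ ^ 2 := by
  have h : Integrable fun x => normSqSchwartz f x := (normSqSchwartz f).integrable
  simp only [normSqSchwartz_apply] at h
  exact_mod_cast h.re

theorem summable_norm_sq_dualLattice (K : 𝓢(Euc n, ℂ)) (w : 𝓢(Euc m, ℂ)) {ε : ℝ} (hε : 0 < ε) :
    Summable fun x : dualLattice Γ =>
      ‖K (x : Euc n × Euc m).1‖ ^ 2 * ‖w (ε • (x : Euc n × Euc m).2)‖ ^ 2 := by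
  have h := summable_schwartz_dualLattice Γ (normSqSchwartz K) (normSqSchwartz w) hε
  simp only [normSqSchwartz_apply, ← Complex.ofReal_mul] at h
  exact Complex.summable_ofReal.1 h

theorem tendsto_tsum_norm_sq_dualLattice (hΓ : Set.InjOn Prod.snd (Γ : Set (Euc n × Euc m)))
    (K : 𝓢(Euc n, ℂ)) (w : 𝓢(Euc m, ℂ)) :
    Tendsto (fun ε : ℝ => ε ^ m * ∑' x : dualLattice Γ,
      ‖K (x : Euc n × Euc m).1‖ ^ 2 * ‖w (ε • (x : Euc n × Euc m).2)‖ ^ 2) (𝓝[>] 0)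
      (𝓝 (poissonConst Γ * ((∫ x, ‖K x‖ ^ 2) * ∫ y, ‖w y‖ ^ 2))) := by
  have h := tendsto_tsum_dualLattice Γ hΓ (normSqSchwartz K) (normSqSchwartz w)
  simp only [normSqSchwartz_apply, ← Complex.ofReal_mul, ← Complex.ofReal_tsum,
    integral_complex_ofReal] at h
  exact (Complex.continuous_re.tendsto _).comp h

end Equidistribution

/-! ### Norms and coefficients in L² of a bounded set. -/

section LTwo

variable {k : ℕ} {S : Set (Euc k)}

theorem norm_sq_eq_integral {μ : Measure (Euc k)} (F : Lp ℂ 2 μ) :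
    ‖F‖ ^ 2 = ∫ x, ‖F x‖ ^ 2 ∂μ := by
  have h : (inner ℂ F F : ℂ) = ((∫ x, ‖F x‖ ^ 2 ∂μ : ℝ) : ℂ) := by
    rw [L2.inner_def, ← integral_complex_ofReal]
    refine integral_congr_ae (ae_of_all _ fun x => ?_)
    simp [inner_self_eq_norm_sq_to_K]
  rw [← inner_self_eq_norm_sq (𝕜 := ℂ) F, h]
  exact Complex.ofReal_re _

theorem norm_sq_toLp {μ : Measure (Euc k)} {f : Euc k → ℂ} (hf : MemLp f 2 μ) :
    ‖hf.toLp f‖ ^ 2 = ∫ x, ‖f x‖ ^ 2 ∂μ := by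
  rw [norm_sq_eq_integral]
  refine integral_congr_ae ?_
  filter_upwards [hf.coeFn_toLp] with x hx
  rw [hx]

theorem memLp_of_continuous (hS : Bornology.IsBounded S) {f : Euc k → ℂ} (hf : Continuous f) :
    MemLp f 2 (volume.restrict S) := by
  -- S need not be measurable, so the bound is proved on its compact closure.
  have : IsFiniteMeasure (volume.restrict (closure S)) :=
    ⟨by rw [Measure.restrict_apply_univ]; exact hS.closure.measure_lt_top⟩
  obtain ⟨C, hC⟩ := hS.isCompact_closure.exists_bound_of_continuousOn hf.continuousOn
  refine MemLp.mono_measure (Measure.restrict_mono subset_closure le_rfl)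
    (MemLp.of_bound hf.aestronglyMeasurable C ?_)
  filter_upwards [ae_restrict_mem isClosed_closure.measurableSet] with x hx using hC x hx

theorem inner_expSystem {Lam : Set (Euc k)} (hS : Bornology.IsBounded S) (lam : Lam)
    (f : Lp ℂ 2 (volume.restrict S)) : (inner ℂ (expSystem Lam hS lam) f : ℂ) =
      ∫ x in S, (starRingEnd ℂ) (expFun (lam : Euc k) x) * f x := by
  rw [L2.inner_def]
  refine integral_congr_ae ?_
  filter_upwards [(memLp_expFun hS (lam : Euc k)).coeFn_toLp] with x hx
  rw [expSystem, hx, RCLike.inner_apply, mul_comm]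

theorem inner_expSystem_toLp {Lam : Set (Euc k)} (hS : Bornology.IsBounded S) (lam : Lam)
    {f : Euc k → ℂ} (hf : MemLp f 2 (volume.restrict S)) :
    (inner ℂ (expSystem Lam hS lam) (hf.toLp f) : ℂ) =
      ∫ x in S, (starRingEnd ℂ) (expFun (lam : Euc k) x) * f x := by
  rw [inner_expSystem]
  refine integral_congr_ae ?_
  filter_upwards [hf.coeFn_toLp] with x hx
  rw [hx]

theorem norm_sq_sum_expSystem {Lam : Set (Euc k)} (hS : Bornology.IsBounded S) (s : Finset Lam)
    (c : Lam → ℂ) : ‖∑ i ∈ s, c i • expSystem Lam hS i‖ ^ 2 =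
      ∫ x in S, ‖∑ i ∈ s, c i * expFun (i : Euc k) x‖ ^ 2 := by
  classical
  have h : (∑ i ∈ s, c i • expSystem Lam hS i : Lp ℂ 2 (volume.restrict S)) =ᵐ[volume.restrict S]
      fun x => ∑ i ∈ s, c i * expFun (i : Euc k) x := by
    induction s using Finset.induction_on with
    | empty => simpa using! Lp.coeFn_zero ℂ 2 (volume.restrict S)
    | insert a s ha ih =>
      rw [Finset.sum_insert ha]
      filter_upwards [ih, Lp.coeFn_add (c a • expSystem Lam hS a) (∑ i ∈ s, c i • expSystem Lam hS i),
        Lp.coeFn_smul (c a) (expSystem Lam hS a),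
        (memLp_expFun hS (a : Euc k)).coeFn_toLp] with x h1 h2 h3 h4
      rw [h2, Pi.add_apply, h1, h3, Pi.smul_apply, Finset.sum_insert ha, expSystem, h4,
        smul_eq_mul]
  rw [norm_sq_eq_integral]
  refine integral_congr_ae ?_
  filter_upwards [h] with x hx
  rw [hx]

theorem contDiff_expFun {N : WithTop ℕ∞} (lam : Euc k) : ContDiff ℝ N (expFun lam) := by
  have h : ContDiff ℝ N fun x : Euc k => ((inner ℝ lam x : ℝ) : ℂ) :=
    Complex.ofRealCLM.contDiff.comp (contDiff_const.inner ℝ contDiff_id)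
  exact (contDiff_const.mul h).cexp

end LTwo

/-! ### Schwartz approximation of a smooth function restricted to U. -/

section Cutoffs

variable {n : ℕ}

/-- Multiply f by θ_j and by a fixed compactly supported bump b equal to 1 on W. The products are
Schwartz functions with common majorant |b f|, and dominated convergence gives the limit. -/
theorem exists_schwartz_cutoff {f : Euc n → ℂ} (hf : ContDiff ℝ ((⊤ : ℕ∞) : WithTop ℕ∞) f)
    {W : Set (Euc n)} (hW : Bornology.IsBounded W) (hWm : MeasurableSet W)
    {θ : ℕ → Euc n → ℝ} (hθ : ∀ j, ContDiff ℝ ((⊤ : ℕ∞) : WithTop ℕ∞) (θ j))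
    (hθ01 : ∀ j x, θ j x ∈ Set.Icc (0 : ℝ) 1)
    (hlim : ∀ x, Tendsto (fun j => θ j x) atTop (𝓝 (W.indicator 1 x))) :
    ∃ η : ℕ → 𝓢(Euc n, ℂ), (∀ j x, ‖η j x‖ ≤ ‖f x‖) ∧ (∀ j x, θ j x = 0 → η j x = 0) ∧
      (∀ j, ∀ x ∈ W, θ j x = 1 → η j x = f x) ∧
      Tendsto (fun j => ∫ x, ‖η j x‖ ^ 2) atTop (𝓝 (∫ x in W, ‖f x‖ ^ 2)) := by
  obtain ⟨R, hR0, hR⟩ := hW.subset_closedBall_lt 0 0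
  let b : ContDiffBump (0 : Euc n) := ⟨R, R + 1, hR0, by linarith⟩
  have hb1 (x : Euc n) (hx : x ∈ W) : b x = 1 := b.one_of_mem_closedBall (hR hx)
  have hsb : HasCompactSupport fun x => (b x : ℂ) :=
    b.hasCompactSupport.comp_left (g := Complex.ofReal) rfl
  have hs (j : ℕ) : HasCompactSupport fun x => (b x : ℂ) * ((θ j x : ℂ) * f x) := hsb.mul_right
  have hbc : ContDiff ℝ ((⊤ : ℕ∞) : WithTop ℕ∞) fun x => (b x : ℂ) :=
    Complex.ofRealCLM.contDiff.comp b.contDiff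
  have hθc (j : ℕ) : ContDiff ℝ ((⊤ : ℕ∞) : WithTop ℕ∞) fun x => (θ j x : ℂ) :=
    Complex.ofRealCLM.contDiff.comp (hθ j)
  have hc (j : ℕ) : ContDiff ℝ ((⊤ : ℕ∞) : WithTop ℕ∞) fun x => (b x : ℂ) * ((θ j x : ℂ) * f x) :=
    hbc.mul ((hθc j).mul hf)
  have happ (j : ℕ) (x : Euc n) : (hs j).toSchwartzMap (hc j) x = (b x : ℂ) * ((θ j x : ℂ) * f x) :=
    rfl
  have hnorm (j : ℕ) (x : Euc n) : ‖(hs j).toSchwartzMap (hc j) x‖ ^ 2 ≤ ‖(b x : ℂ) * f x‖ ^ 2 := by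
    rw [happ]
    simp only [norm_mul, Complex.norm_real, Real.norm_of_nonneg b.nonneg,
      Real.norm_of_nonneg (hθ01 j x).1]
    have h0 := b.nonneg (x := x)
    have h1 : θ j x * ‖f x‖ ≤ ‖f x‖ := mul_le_of_le_one_left (norm_nonneg _) (hθ01 j x).2
    have h2 : 0 ≤ θ j x * ‖f x‖ := mul_nonneg (hθ01 j x).1 (norm_nonneg _)
    exact pow_le_pow_left₀ (mul_nonneg h0 h2) (mul_le_mul_of_nonneg_left h1 h0) 2
  refine ⟨fun j => (hs j).toSchwartzMap (hc j), fun j x => ?_, fun j x h => ?_, fun j x hx h => ?_,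
    ?_⟩
  · refine le_of_sq_le_sq ((hnorm j x).trans ?_) (norm_nonneg _)
    gcongr
    rw [norm_mul, Complex.norm_real, Real.norm_of_nonneg b.nonneg]
    exact mul_le_of_le_one_left (norm_nonneg _) b.le_one
  · simp [happ, h]
  · simp [happ, h, hb1 x hx]
  · rw [← integral_indicator hWm]
    refine tendsto_integral_of_dominated_convergence (fun x => ‖(b x : ℂ) * f x‖ ^ 2)
      (fun j => ((hs j).toSchwartzMap (hc j)).continuous.norm.pow 2 |>.aestronglyMeasurable) ?_
      (fun j => ae_of_all _ fun x => ?_) (ae_of_all _ fun x => ?_)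
    · refine Continuous.integrable_of_hasCompactSupport ?_
        ((hsb.mul_right (f' := f)).comp_left (g := fun z : ℂ => ‖z‖ ^ 2) (by simp))
      have := hf.continuous
      have := hbc.continuous
      fun_prop
    · rw [Real.norm_of_nonneg (by positivity)]
      exact hnorm j x
    · have h1 : Tendsto (fun j => ‖(b x : ℂ) * ((θ j x : ℂ) * f x)‖ ^ 2) atTop
          (𝓝 (‖(b x : ℂ) * (((W.indicator 1 x : ℝ) : ℂ) * f x)‖ ^ 2)) :=
        ((((Complex.continuous_ofReal.tendsto _).comp (hlim x)).mul_const _).const_mul _).norm.pow 2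
      convert! h1 using 2
      by_cases hx : x ∈ W
      · simp [hx, hb1 x hx]
      · simp [hx]

theorem tendsto_one_sub_pow_indicator {g : Euc n → ℝ} (hg : Set.range g ⊆ Set.Icc 0 1)
    (x : Euc n) : Tendsto (fun j : ℕ => (1 - g x) ^ j) atTop
      (𝓝 ((Function.support g)ᶜ.indicator 1 x)) := by
  have h01 := hg ⟨x, rfl⟩
  by_cases hx : g x = 0
  · simp [hx]
  · rw [Set.indicator_of_notMem (by simpa using hx)]
    have : 0 < g x := lt_of_le_of_ne h01.1 (Ne.symm hx)
    exact tendsto_pow_atTop_nhds_zero_of_lt_one (by linarith [h01.2]) (by linarith)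

/-- Smooth approximation of `f` on `U` from outside. -/
theorem exists_schwartz_approx_outer {U : Set (Euc n)} (hU : RiemannMeasurable U) {f : Euc n → ℂ}
    (hf : ContDiff ℝ ((⊤ : ℕ∞) : WithTop ℕ∞) f) :
    ∃ η : ℕ → 𝓢(Euc n, ℂ), (∀ j, ∀ x ∈ U, η j x = f x) ∧
      Tendsto (fun j => ∫ x, ‖η j x‖ ^ 2) atTop (𝓝 (∫ x in U, ‖f x‖ ^ 2)) := by
  -- The zero set of g is the closure of U, so the cutoffs (1 - g)^j equal 1 there and decrease to
  -- its indicator.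
  obtain ⟨g, hgs, hg, hg01⟩ :=
    (isClosed_closure (s := U)).isOpen_compl.exists_contDiff_support_eq (n := ⊤)
  have hlim := tendsto_one_sub_pow_indicator hg01
  rw [hgs, compl_compl] at hlim
  obtain ⟨η, -, -, h2, h3⟩ := exists_schwartz_cutoff hf hU.bounded.closure
    isClosed_closure.measurableSet (θ := fun j x => (1 - g x) ^ j)
    (fun j => (contDiff_const.sub hg).pow j) (fun j x => by
      have := hg01 ⟨x, rfl⟩
      exact ⟨pow_nonneg (by linarith [this.2]) _, pow_le_one₀ (by linarith [this.2])
        (by linarith [this.1])⟩) hlim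
  refine ⟨η, fun j x hx => h2 j x (subset_closure hx) ?_, ?_⟩
  · have : g x = 0 := by
      by_contra h
      have hx' : x ∈ Function.support g := h
      rw [hgs] at hx'
      exact hx' (subset_closure hx)
    simp [this]
  · rwa [setIntegral_congr_set (closure_ae_eq_of_null_frontier hU.null_frontier)] at h3

/-- Smooth approximation of `f` on `U` from inside. -/
theorem exists_schwartz_approx_inner {U : Set (Euc n)} (hU : RiemannMeasurable U) {f : Euc n → ℂ}
    (hf : ContDiff ℝ ((⊤ : ℕ∞) : WithTop ℕ∞) f) :
    ∃ η : ℕ → 𝓢(Euc n, ℂ), (∀ j x, ‖η j x‖ ≤ ‖f x‖) ∧ (∀ j, ∀ x ∉ U, η j x = 0) ∧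
      Tendsto (fun j => ∫ x, ‖η j x‖ ^ 2) atTop (𝓝 (∫ x in U, ‖f x‖ ^ 2)) := by
  -- Here g is positive exactly on the interior of U, so 1 - (1 - g)^j vanishes off it and increases
  -- to its indicator.
  obtain ⟨g, hgs, hg, hg01⟩ := (isOpen_interior (s := U)).exists_contDiff_support_eq (n := ⊤)
  obtain ⟨η, h1, h2, -, h3⟩ := exists_schwartz_cutoff hf (hU.bounded.subset interior_subset)
    isOpen_interior.measurableSet (θ := fun j x => 1 - (1 - g x) ^ j)
    (fun j => contDiff_const.sub ((contDiff_const.sub hg).pow j)) (fun j x => by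
      have := hg01 ⟨x, rfl⟩
      have h0 : 0 ≤ (1 - g x) ^ j := pow_nonneg (by linarith [this.2]) _
      have h1 : (1 - g x) ^ j ≤ 1 := pow_le_one₀ (by linarith [this.2]) (by linarith [this.1])
      constructor <;> linarith) (fun x => by
      have h := (tendsto_one_sub_pow_indicator hg01 x).const_sub 1
      rw [hgs] at h
      convert! h using 2
      by_cases hx : x ∈ interior U <;> simp [hx])
  refine ⟨η, h1, fun j x hx => h2 j x ?_, ?_⟩
  · have : g x = 0 := by
      by_contra h
      have hx' : x ∈ Function.support g := h
      rw [hgs] at hx'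
      exact hx (interior_subset hx')
    simp [this]
  · rwa [setIntegral_congr_set (interior_ae_eq_of_null_frontier hU.null_frontier)] at h3

end Cutoffs

/-! ### Model sets parametrized by lattice points. -/

section Reindexing

variable {n m : ℕ} {Γ : Submodule ℤ (Euc n × Euc m)}

/-- The dual lattice points over `U`. -/
def pointsOver (Γ : Submodule ℤ (Euc n × Euc m)) (U : Set (Euc n)) : Set (dualLattice Γ) :=
  {y : dualLattice Γ | (y : Euc n × Euc m).1 ∈ U}

/-- The lattice points over `V`. -/
def latticePointsOver (Γ : Submodule ℤ (Euc n × Euc m)) (V : Set (Euc m)) : Set Γ :=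
  {x : Γ | (x : Euc n × Euc m).2 ∈ V}

/-- The dual model set is parametrized by the dual lattice points over `U`. -/
noncomputable def dualModelSetEquiv (hΓ : GeneralPosition Γ) (U : Set (Euc n)) :
    pointsOver Γ U ≃ dualModelSet Γ U :=
  Equiv.ofBijective (fun y => ⟨(y.1 : Euc n × Euc m).2, y.1, y.1.2, y.2, rfl⟩) <| by
    constructor
    · intro a b h
      exact Subtype.ext (Subtype.ext (hΓ.injOn_snd_dualLattice a.1.2 b.1.2 (Subtype.ext_iff.1 h)))
    · rintro ⟨_, y, hy, hyU, rfl⟩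
      exact ⟨⟨⟨y, hy⟩, hyU⟩, rfl⟩

theorem coe_dualModelSetEquiv (hΓ : GeneralPosition Γ) (U : Set (Euc n))
    (y : pointsOver Γ U) :
    (dualModelSetEquiv hΓ U y : Euc m) = (y.1 : Euc n × Euc m).2 := rfl

/-- The model set is parametrized by the lattice points over `V`. -/
noncomputable def modelSetEquiv (hΓ : GeneralPosition Γ) (V : Set (Euc m)) :
    latticePointsOver Γ V ≃ modelSet Γ V :=
  Equiv.ofBijective (fun y => ⟨(y.1 : Euc n × Euc m).1, y.1, y.1.2, y.2, rfl⟩) <| by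
    constructor
    · intro a b h
      exact Subtype.ext (Subtype.ext (hΓ.injOn_fst a.1.2 b.1.2 (Subtype.ext_iff.1 h)))
    · rintro ⟨_, y, hy, hyV, rfl⟩
      exact ⟨⟨⟨y, hy⟩, hyV⟩, rfl⟩

theorem coe_modelSetEquiv (hΓ : GeneralPosition Γ) (V : Set (Euc m))
    (x : latticePointsOver Γ V) :
    (modelSetEquiv hΓ V x : Euc n) = (x.1 : Euc n × Euc m).1 := rfl

end Reindexing

/-! ### From a frame over V to a Riesz sequence over U. -/

section FrameToRiesz

variable {n m : ℕ} {Γ : Submodule ℤ (Euc n × Euc m)}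

theorem norm_sq_sum_of_disjoint {κ : Type*} (s : Finset κ) (a d : κ → ℂ)
    (h : ∀ i ∈ s, ∀ j ∈ s, i ≠ j → d i * (starRingEnd ℂ) (d j) = 0) :
    ‖∑ i ∈ s, a i * d i‖ ^ 2 = ∑ i ∈ s, ‖a i‖ ^ 2 * ‖d i‖ ^ 2 := by
  have h1 : (((‖∑ i ∈ s, a i * d i‖ ^ 2 : ℝ)) : ℂ) =
      ((∑ i ∈ s, ‖a i‖ ^ 2 * ‖d i‖ ^ 2 : ℝ) : ℂ) := by
    push_cast
    rw [← Complex.mul_conj', map_sum, Finset.sum_mul_sum]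
    refine Finset.sum_congr rfl fun i hi => ?_
    rw [Finset.sum_eq_single_of_mem i hi]
    · rw [Complex.mul_conj', norm_mul]
      push_cast
      ring
    · intro j hj hji
      rw [map_mul, mul_mul_mul_comm, h i hi j hj hji.symm, mul_zero]
  exact Complex.ofReal_injective h1

/-- The frame coefficients of a combination of small bumps placed at lattice points. -/
theorem integral_conj_expFun_mul_sum_dil {κ : Type*} (φ : 𝓢(Euc m, ℂ)) (s : Finset κ) (c : κ → ℂ)
    {γ : κ → Euc n × Euc m} (hγ : ∀ i, γ i ∈ Γ) {y : Euc n × Euc m} (hy : y ∈ dualLattice Γ)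
    {ε : ℝ} (hε : 0 < ε) :
    ∫ z, (starRingEnd ℂ) (expFun y.2 z) * ∑ i ∈ s, c i * dil φ ε (γ i).2 z =
      (ε ^ m : ℝ) * ((∑ i ∈ s, c i * expFun (γ i).1 y.1) * 𝓕 (φ : Euc m → ℂ) (ε • y.2)) := by
  have hint (i : κ) : Integrable fun z =>
      c i * ((starRingEnd ℂ) (expFun y.2 z) * dil φ ε (γ i).2 z) := by
    refine ((integrable_dil φ hε (γ i).2).bdd_mul (c := 1) ?_ (ae_of_all _ fun z => ?_)).const_mul _
    · exact (Complex.continuous_conj.comp (continuous_expFun _)).aestronglyMeasurable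
    · rw [RCLike.norm_conj, norm_expFun]
  have h1 (z : Euc m) : (starRingEnd ℂ) (expFun y.2 z) * ∑ i ∈ s, c i * dil φ ε (γ i).2 z =
      ∑ i ∈ s, c i * ((starRingEnd ℂ) (expFun y.2 z) * dil φ ε (γ i).2 z) := by
    rw [Finset.mul_sum]
    exact Finset.sum_congr rfl fun i _ => mul_left_comm _ _ _
  simp only [h1]
  rw [integral_finsetSum _ fun i _ => hint i, Finset.sum_mul, Finset.mul_sum]
  refine Finset.sum_congr rfl fun i _ => ?_
  rw [integral_const_mul, integral_conj_expFun_mul_dil φ hε, conj_expFun_of_mem (hγ i) hy]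
  ring

theorem integral_norm_sq_sum_dil {κ : Type*} (φ : 𝓢(Euc m, ℂ)) (s : Finset κ) (c : κ → ℂ)
    (v : κ → Euc m) {ε : ℝ} (hε : 0 < ε)
    (h : ∀ i ∈ s, ∀ j ∈ s, i ≠ j → ∀ z, dil φ ε (v i) z * (starRingEnd ℂ) (dil φ ε (v j) z) = 0) :
    ∫ z, ‖∑ i ∈ s, c i * dil φ ε (v i) z‖ ^ 2 =
      ε ^ m * ((∫ z, ‖φ z‖ ^ 2) * ∑ i ∈ s, ‖c i‖ ^ 2) := by
  have h1 (z : Euc m) : ‖∑ i ∈ s, c i * dil φ ε (v i) z‖ ^ 2 =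
      ∑ i ∈ s, ‖c i‖ ^ 2 * ‖dil φ ε (v i) z‖ ^ 2 :=
    norm_sq_sum_of_disjoint s c _ fun i hi j hj hij => h i hi j hj hij z
  simp only [h1]
  rw [integral_finsetSum]
  · rw [Finset.mul_sum, Finset.mul_sum]
    refine Finset.sum_congr rfl fun i _ => ?_
    rw [integral_const_mul, integral_norm_sq_dil _ hε]
    ring
  · intro i _
    exact (((integrable_norm_sq_schwartz φ).comp_smul (inv_pos.2 hε).ne').comp_sub_right
      (v i)).const_mul _

/-- The squared modulus of `g ⊗ w`, the second factor dilated, at a dual lattice point. -/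
noncomputable def stripTerm (Γ : Submodule ℤ (Euc n × Euc m)) (g : Euc n → ℂ) (w : Euc m → ℂ)
    (ε : ℝ) (y : dualLattice Γ) : ℝ :=
  ‖g (y : Euc n × Euc m).1‖ ^ 2 * ‖w (ε • (y : Euc n × Euc m).2)‖ ^ 2

theorem stripTerm_nonneg (g : Euc n → ℂ) (w : Euc m → ℂ) (ε : ℝ) (y : dualLattice Γ) :
    0 ≤ stripTerm Γ g w ε y := by
  unfold stripTerm; positivity

/-- The frame inequalities, tested on small bumps placed at lattice points over `V`. -/
theorem eventually_frame_inequality (hΓ : GeneralPosition Γ) {U : Set (Euc n)} {V : Set (Euc m)}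
    (hV : Bornology.IsBounded V) {u : Euc m} (hu : IsWindow Γ V u) {φ : 𝓢(Euc m, ℂ)}
    (hφ : ∀ x ∉ Metric.ball u (1 / 2), φ x = 0) {A B : ℝ}
    (hF : ∀ x : Lp ℂ 2 (volume.restrict V),
      Summable (fun i => ‖(inner ℂ (expSystem (dualModelSet Γ U) hV i) x : ℂ)‖ ^ 2) ∧
      A * ‖x‖ ^ 2 ≤ ∑' i, ‖(inner ℂ (expSystem (dualModelSet Γ U) hV i) x : ℂ)‖ ^ 2 ∧
      ∑' i, ‖(inner ℂ (expSystem (dualModelSet Γ U) hV i) x : ℂ)‖ ^ 2 ≤ B * ‖x‖ ^ 2)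
    {κ : Type*} (s : Finset κ) (c : κ → ℂ) {γ : κ → Euc n × Euc m} (hγ : ∀ i, γ i ∈ Γ)
    (hγV : ∀ i, (γ i).2 ∈ V) (hγinj : Function.Injective γ) {f : Euc n → ℂ}
    (hf : ∀ x, f x = ∑ i ∈ s, c i * expFun (γ i).1 x) :
    ∀ᶠ ε : ℝ in 𝓝[>] 0,
      Summable ((pointsOver Γ U).indicator (stripTerm Γ f (𝓕 (φ : Euc m → ℂ)) ε)) ∧
      A * ((∫ z, ‖φ z‖ ^ 2) * ∑ i ∈ s, ‖c i‖ ^ 2) ≤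
        ε ^ m * ∑' y, (pointsOver Γ U).indicator (stripTerm Γ f (𝓕 (φ : Euc m → ℂ)) ε) y ∧
      ε ^ m * ∑' y, (pointsOver Γ U).indicator (stripTerm Γ f (𝓕 (φ : Euc m → ℂ)) ε) y ≤
        B * ((∫ z, ‖φ z‖ ^ 2) * ∑ i ∈ s, ‖c i‖ ^ 2) := by
  have hout : ∀ᶠ ε : ℝ in 𝓝[>] 0, ∀ i ∈ s, ∀ z ∉ V, dil φ ε (γ i).2 z = 0 :=
    (Filter.eventually_all_finset s).2 fun i _ => hu.eventually_dil_mem hφ (hγ i) (hγV i)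
  have hdis : ∀ᶠ ε : ℝ in 𝓝[>] 0, ∀ i ∈ s, ∀ j ∈ s, i ≠ j →
      ∀ z, dil φ ε (γ i).2 z * (starRingEnd ℂ) (dil φ ε (γ j).2 z) = 0 := by
    refine (Filter.eventually_all_finset s).2 fun i _ => (Filter.eventually_all_finset s).2
      fun j _ => ?_
    by_cases hij : i = j
    · exact Eventually.of_forall fun _ h => absurd hij h
    · refine (eventually_dil_disjoint hφ fun h => hij (hγinj ?_)).mono fun _ h _ => h
      exact hΓ.injOn_snd (hγ i) (hγ j) h
  filter_upwards [hout, hdis, self_mem_nhdsWithin] with ε hout hdis (hε : 0 < ε)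
  set F : Euc m → ℂ := fun z => ∑ i ∈ s, c i * dil φ ε (γ i).2 z with hFdef
  have hFc : Continuous F :=
    continuous_finsetSum _ fun i _ => continuous_const.mul (continuous_dil φ ε _)
  have hF0 (z : Euc m) (hz : z ∉ V) : F z = 0 :=
    Finset.sum_eq_zero fun i hi => by rw [hout i hi z hz, mul_zero]
  have hFm := memLp_of_continuous hV hFc
  have hnorm : ‖hFm.toLp F‖ ^ 2 = ε ^ m * ((∫ z, ‖φ z‖ ^ 2) * ∑ i ∈ s, ‖c i‖ ^ 2) := by
    rw [norm_sq_toLp, setIntegral_eq_integral_of_forall_compl_eq_zero fun z hz => by simp [hF0 z hz]]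
    exact integral_norm_sq_sum_dil φ s c _ hε hdis
  have hcoef (y : pointsOver Γ U) :
      ‖(inner ℂ (expSystem (dualModelSet Γ U) hV (dualModelSetEquiv hΓ U y)) (hFm.toLp F) : ℂ)‖ ^ 2 =
      (ε ^ m) ^ 2 * stripTerm Γ f (𝓕 (φ : Euc m → ℂ)) ε y := by
    rw [inner_expSystem_toLp, coe_dualModelSetEquiv,
      setIntegral_eq_integral_of_forall_compl_eq_zero fun z hz => by rw [hF0 z hz, mul_zero],
      integral_conj_expFun_mul_sum_dil φ s c hγ y.1.2 hε, norm_mul, norm_mul, Complex.norm_real,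
      Real.norm_of_nonneg (by positivity), mul_pow, mul_pow, stripTerm, hf]
  obtain ⟨h1, h2, h3⟩ := hF (hFm.toLp F)
  rw [← (dualModelSetEquiv hΓ U).summable_iff] at h1
  rw [← (dualModelSetEquiv hΓ U).tsum_eq] at h2 h3
  have e1 : ∑' y, ‖(inner ℂ (expSystem (dualModelSet Γ U) hV (dualModelSetEquiv hΓ U y))
      (hFm.toLp F) : ℂ)‖ ^ 2 = (ε ^ m) ^ 2 *
        ∑' y, (pointsOver Γ U).indicator (stripTerm Γ f (𝓕 (φ : Euc m → ℂ)) ε) y := by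
    rw [← tsum_subtype, ← tsum_mul_left]
    exact tsum_congr hcoef
  -- The norm scales like ε^m and the squared coefficients like ε^{2m}; cancelling one ε^m leaves
  -- the normalization of the equidistribution limit.
  rw [e1, hnorm] at h2 h3
  replace h1 : Summable fun y : pointsOver Γ U =>
      (ε ^ m) ^ 2 * stripTerm Γ f (𝓕 (φ : Euc m → ℂ)) ε y := h1.congr hcoef
  have hεm : 0 < ε ^ m := pow_pos hε m
  refine ⟨?_, ?_, ?_⟩
  · rw [summable_mul_left_iff (by positivity)] at h1
    exact summable_subtype_iff_indicator.1 h1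
  · rw [sq, mul_assoc, mul_left_comm] at h2
    exact le_of_mul_le_mul_left h2 hεm
  · rw [sq, mul_assoc, mul_left_comm B] at h3
    exact le_of_mul_le_mul_left h3 hεm

variable [DiscreteTopology Γ] [IsZLattice ℝ Γ]

theorem summable_stripTerm (η : 𝓢(Euc n, ℂ)) (φ : 𝓢(Euc m, ℂ)) {ε : ℝ} (hε : 0 < ε) :
    Summable (stripTerm Γ η (𝓕 (φ : Euc m → ℂ)) ε) :=
  summable_norm_sq_dualLattice Γ η (𝓕 φ) hε

/-- Equidistribution for η and φ̂; Plancherel replaces the norm of φ̂ by that of φ. -/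
theorem tendsto_tsum_stripTerm (hΓ : GeneralPosition Γ) (η : 𝓢(Euc n, ℂ)) (φ : 𝓢(Euc m, ℂ)) :
    Tendsto (fun ε : ℝ => ε ^ m * ∑' y, stripTerm Γ η (𝓕 (φ : Euc m → ℂ)) ε y) (𝓝[>] 0)
      (𝓝 (poissonConst Γ * ((∫ x, ‖η x‖ ^ 2) * ∫ z, ‖φ z‖ ^ 2))) := by
  rw [← SchwartzMap.integral_norm_sq_fourier φ]
  exact tendsto_tsum_norm_sq_dualLattice Γ hΓ.injOn_snd η (𝓕 φ)

/-- Equidistribution is known only for Schwartz functions, so f restricted to U is majorized by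
Schwartz functions equal to f on U. The limit ε → 0 is taken for fixed j, then j → ∞. -/
theorem le_integral_of_eventually_le_tsum (hΓ : GeneralPosition Γ) {U : Set (Euc n)}
    (hU : RiemannMeasurable U) {f : Euc n → ℂ} (hf : ContDiff ℝ ((⊤ : ℕ∞) : WithTop ℕ∞) f)
    (φ : 𝓢(Euc m, ℂ)) {X : ℝ} (h : ∀ᶠ ε : ℝ in 𝓝[>] 0,
      Summable ((pointsOver Γ U).indicator (stripTerm Γ f (𝓕 (φ : Euc m → ℂ)) ε)) ∧
      X ≤ ε ^ m * ∑' y, (pointsOver Γ U).indicator (stripTerm Γ f (𝓕 (φ : Euc m → ℂ)) ε) y) :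
    X ≤ poissonConst Γ * ((∫ x in U, ‖f x‖ ^ 2) * ∫ z, ‖φ z‖ ^ 2) := by
  obtain ⟨η, hη, hηlim⟩ := exists_schwartz_approx_outer hU hf
  refine ge_of_tendsto' ((hηlim.mul_const _).const_mul _) fun j => ?_
  refine ge_of_tendsto (tendsto_tsum_stripTerm hΓ (η j) φ) ?_
  filter_upwards [h, self_mem_nhdsWithin] with ε hε (hε0 : 0 < ε)
  refine hε.2.trans (mul_le_mul_of_nonneg_left ?_ (by positivity))
  refine hε.1.tsum_le_tsum (fun y => ?_) (summable_stripTerm (η j) φ hε0)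
  by_cases hy : y ∈ pointsOver Γ U
  · rw [Set.indicator_of_mem hy, stripTerm, stripTerm, hη j _ hy]
  · rw [Set.indicator_of_notMem hy]
    exact stripTerm_nonneg _ _ _ _

theorem integral_le_of_eventually_tsum_le (hΓ : GeneralPosition Γ) {U : Set (Euc n)}
    (hU : RiemannMeasurable U) {f : Euc n → ℂ} (hf : ContDiff ℝ ((⊤ : ℕ∞) : WithTop ℕ∞) f)
    (φ : 𝓢(Euc m, ℂ)) {X : ℝ} (h : ∀ᶠ ε : ℝ in 𝓝[>] 0,
      Summable ((pointsOver Γ U).indicator (stripTerm Γ f (𝓕 (φ : Euc m → ℂ)) ε)) ∧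
      ε ^ m * ∑' y, (pointsOver Γ U).indicator (stripTerm Γ f (𝓕 (φ : Euc m → ℂ)) ε) y ≤ X) :
    poissonConst Γ * ((∫ x in U, ‖f x‖ ^ 2) * ∫ z, ‖φ z‖ ^ 2) ≤ X := by
  obtain ⟨η, hη, hη0, hηlim⟩ := exists_schwartz_approx_inner hU hf
  refine le_of_tendsto' ((hηlim.mul_const _).const_mul _) fun j => ?_
  refine le_of_tendsto (tendsto_tsum_stripTerm hΓ (η j) φ) ?_
  filter_upwards [h, self_mem_nhdsWithin] with ε hε (hε0 : 0 < ε)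
  refine le_trans (mul_le_mul_of_nonneg_left ?_ (by positivity)) hε.2
  refine (summable_stripTerm (η j) φ hε0).tsum_le_tsum (fun y => ?_) hε.1
  by_cases hy : y ∈ pointsOver Γ U
  · rw [Set.indicator_of_mem hy, stripTerm, stripTerm]
    gcongr
    exact hη j _
  · rw [Set.indicator_of_notMem hy, stripTerm, hη0 j _ hy]
    simp

/-- Both limits carry the factor ∫|φ|² > 0, which cancels, so the bounds do not depend on the chosen
bump. -/
theorem isRieszSequence_of_isFrame (hΓ : GeneralPosition Γ) {U : Set (Euc n)}
    (hU : RiemannMeasurable U) {V : Set (Euc m)} (hV : RiemannMeasurable V) {u : Euc m}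
    (hu : IsWindow Γ V u) (hF : IsFrame (expSystem (dualModelSet Γ U) hV.bounded)) :
    IsRieszSequence (expSystem (modelSet Γ V) hU.bounded) := by
  obtain ⟨A, B, hA, hB, hF⟩ := hF
  obtain ⟨φ, hφ, hφ0⟩ := exists_schwartz_bump u
  have hC := poissonConst_pos Γ
  refine ⟨A / poissonConst Γ, B / poissonConst Γ, by positivity, by positivity, fun s c => ?_⟩
  set γ : modelSet Γ V → Euc n × Euc m := fun i => ((modelSetEquiv hΓ V).symm i).1 with hγdef
  have hγ (i : modelSet Γ V) : γ i ∈ Γ := ((modelSetEquiv hΓ V).symm i).1.2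
  have hγV (i : modelSet Γ V) : (γ i).2 ∈ V := ((modelSetEquiv hΓ V).symm i).2
  have hγ1 (i : modelSet Γ V) : (γ i).1 = i := by
    rw [hγdef, ← coe_modelSetEquiv hΓ V, Equiv.apply_symm_apply]
  have hγinj : Function.Injective γ := fun i j h => Subtype.ext (by rw [← hγ1, h, hγ1])
  have hfc : ContDiff ℝ ((⊤ : ℕ∞) : WithTop ℕ∞) fun x => ∑ i ∈ s, c i * expFun (i : Euc n) x :=
    ContDiff.sum fun i _ => contDiff_const.mul (contDiff_expFun _)
  have hmain := eventually_frame_inequality hΓ hV.bounded hu hφ hF s c hγ hγV hγinj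
    (f := fun x => ∑ i ∈ s, c i * expFun (i : Euc n) x) fun x => by simp only [hγ1]
  have h1 := le_integral_of_eventually_le_tsum hΓ hU hfc φ (hmain.mono fun ε h => ⟨h.1, h.2.1⟩)
  have h2 := integral_le_of_eventually_tsum_le hΓ hU hfc φ (hmain.mono fun ε h => ⟨h.1, h.2.2⟩)
  rw [norm_sq_sum_expSystem, div_mul_eq_mul_div, div_mul_eq_mul_div, div_le_iff₀ hC, le_div_iff₀ hC]
  constructor
  · exact le_of_mul_le_mul_right (by linarith) hφ0
  · exact le_of_mul_le_mul_right (by linarith) hφ0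

end FrameToRiesz

/-! ### L² norms over V of infinite sums of bumps. -/

section BumpSums

variable {n m : ℕ} {Γ : Submodule ℤ (Euc n × Euc m)} {V : Set (Euc m)} {u : Euc m}
  {φ : 𝓢(Euc m, ℂ)}

/-- V differs from its interior by a null set; this licenses almost everywhere arguments on V
without assuming measurability. -/
theorem RiemannMeasurable.nullMeasurableSet (hV : RiemannMeasurable V) :
    NullMeasurableSet V volume :=
  isOpen_interior.measurableSet.nullMeasurableSet.congr
    (interior_ae_eq_of_null_frontier hV.null_frontier)

/-- A dilated bump that does not vanish identically on a bounded set is centered in a bounded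
set. -/
theorem exists_one_le_wt_of_dil_ne_zero (hV : Bornology.IsBounded V)
    (hφ : ∀ x ∉ Metric.ball u (1 / 2), φ x = 0) (r : ℕ) :
    ∃ K : ℝ, 0 ≤ K ∧ ∀ ε ∈ Set.Ioo (0 : ℝ) 1, ∀ v, ∀ y ∈ V, dil φ ε v y ≠ 0 → 1 ≤ K * wt r v := by
  obtain ⟨R, hR⟩ := hV.exists_norm_le
  refine ⟨(1 + (|R| + (‖u‖ + 1 / 2))) ^ r, by positivity, fun ε hε v y hy h => ?_⟩
  obtain ⟨w, hw, rfl⟩ := exists_of_dil_ne_zero hφ hε.1 h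
  rw [wt, ← div_eq_mul_inv, one_le_div (by positivity)]
  gcongr
  have hw' : ‖w‖ ≤ ‖u‖ + 1 / 2 := by
    have := norm_le_norm_add_norm_sub' w u
    rw [mem_ball_iff_norm] at hw
    linarith
  calc ‖v‖ = ‖(v + ε • w) - ε • w‖ := by rw [add_sub_cancel_right]
    _ ≤ ‖v + ε • w‖ + ‖ε • w‖ := norm_sub_le _ _
    _ ≤ |R| + (‖u‖ + 1 / 2) := by
        refine add_le_add ((hR _ hy).trans (le_abs_self R)) (le_trans ?_ hw')
        rw [norm_smul, Real.norm_of_nonneg hε.1.le]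
        exact mul_le_of_le_one_left (norm_nonneg _) hε.2.le

theorem exists_norm_dil_le (φ : 𝓢(Euc m, ℂ)) : ∃ M : ℝ, 0 ≤ M ∧ ∀ ε v y, ‖dil φ ε v y‖ ≤ M := by
  obtain ⟨-, C, hC, h⟩ := decays_schwartz 0 φ
  exact ⟨C, hC, fun ε v y => (h _).trans (by simp [wt])⟩

/-- The contribution of a pair of lattice points to the square integral of a sum of bumps. -/
noncomputable def pairTerm (φ : 𝓢(Euc m, ℂ)) (V : Set (Euc m)) (a : Γ → ℂ) (ε : ℝ) (p : Γ × Γ) : ℂ :=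
  ∫ y in V, (a p.1 * dil φ ε (p.1 : Euc n × Euc m).2 y) *
    (starRingEnd ℂ) (a p.2 * dil φ ε (p.2 : Euc n × Euc m).2 y)

/-- If both bumps are nonzero at a point of V, their centers are bounded and two factors K · wt ≥ 1
can be inserted. One bump is kept so that integration produces ε^m; the other is bounded by its
supremum. -/
theorem exists_norm_pair_le (hV : Bornology.IsBounded V)
    (hφ : ∀ x ∉ Metric.ball u (1 / 2), φ x = 0) (r : ℕ) (a : Γ → ℂ) :
    ∃ Q : ℝ, 0 ≤ Q ∧ ∀ ε ∈ Set.Ioo (0 : ℝ) 1, ∀ p : Γ × Γ, ∀ y ∈ V,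
      ‖(a p.1 * dil φ ε (p.1 : Euc n × Euc m).2 y) *
        (starRingEnd ℂ) (a p.2 * dil φ ε (p.2 : Euc n × Euc m).2 y)‖ ≤
      Q * ((‖a p.1‖ * wt r (p.1 : Euc n × Euc m).2) * (‖a p.2‖ * wt r (p.2 : Euc n × Euc m).2)) *
        ‖dil φ ε (p.1 : Euc n × Euc m).2 y‖ := by
  obtain ⟨K, hK, hwt⟩ := exists_one_le_wt_of_dil_ne_zero hV hφ r
  obtain ⟨M, hM, hle⟩ := exists_norm_dil_le φ
  refine ⟨K * K * M, by positivity, fun ε hε p y hy => ?_⟩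
  have hw1 := wt_pos r (p.1 : Euc n × Euc m).2
  have hw2 := wt_pos r (p.2 : Euc n × Euc m).2
  have h0 : 0 ≤ K * K * M * ((‖a p.1‖ * wt r (p.1 : Euc n × Euc m).2) *
      (‖a p.2‖ * wt r (p.2 : Euc n × Euc m).2)) * ‖dil φ ε (p.1 : Euc n × Euc m).2 y‖ := by
    positivity
  by_cases h1 : dil φ ε (p.1 : Euc n × Euc m).2 y = 0
  · simp [h1]
  by_cases h2 : dil φ ε (p.2 : Euc n × Euc m).2 y = 0
  · simpa [h2] using h0
  have e1 := hwt ε hε _ y hy h1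
  have e2 := hwt ε hε _ y hy h2
  have e3 := hle ε (p.2 : Euc n × Euc m).2 y
  rw [norm_mul, RCLike.norm_conj, norm_mul, norm_mul]
  calc ‖a p.1‖ * ‖dil φ ε (p.1 : Euc n × Euc m).2 y‖ *
        (‖a p.2‖ * ‖dil φ ε (p.2 : Euc n × Euc m).2 y‖)
      ≤ ‖a p.1‖ * ‖dil φ ε (p.1 : Euc n × Euc m).2 y‖ * (‖a p.2‖ * M) * (1 * 1) := by
        rw [mul_one, mul_one]
        gcongr
    _ ≤ ‖a p.1‖ * ‖dil φ ε (p.1 : Euc n × Euc m).2 y‖ * (‖a p.2‖ * M) *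
        ((K * wt r (p.1 : Euc n × Euc m).2) * (K * wt r (p.2 : Euc n × Euc m).2)) := by
        gcongr
    _ = _ := by ring

variable {r : ℕ} {a : Γ → ℂ}

theorem integrableOn_pair (φ : 𝓢(Euc m, ℂ)) (hV : Bornology.IsBounded V) (a : Γ → ℂ) (ε : ℝ)
    (p : Γ × Γ) : Integrable (fun y => (a p.1 * dil φ ε (p.1 : Euc n × Euc m).2 y) *
      (starRingEnd ℂ) (a p.2 * dil φ ε (p.2 : Euc n × Euc m).2 y)) (volume.restrict V) := by
  have h1 : Continuous fun y => a p.1 * dil φ ε (p.1 : Euc n × Euc m).2 y :=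
    continuous_const.mul (continuous_dil φ ε _)
  have h2 : Continuous fun y => (starRingEnd ℂ) (a p.2 * dil φ ε (p.2 : Euc n × Euc m).2 y) :=
    Complex.continuous_conj.comp (continuous_const.mul (continuous_dil φ ε _))
  exact (memLp_of_continuous hV h1).integrable_mul (memLp_of_continuous hV h2)

theorem exists_integral_norm_pair_le (hV : RiemannMeasurable V)
    (hφ : ∀ x ∉ Metric.ball u (1 / 2), φ x = 0) (r : ℕ) (a : Γ → ℂ) :
    ∃ Q : ℝ, 0 ≤ Q ∧ ∀ ε ∈ Set.Ioo (0 : ℝ) 1, ∀ p : Γ × Γ,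
      ∫ y in V, ‖(a p.1 * dil φ ε (p.1 : Euc n × Euc m).2 y) *
        (starRingEnd ℂ) (a p.2 * dil φ ε (p.2 : Euc n × Euc m).2 y)‖ ≤
      ε ^ m * (Q * ((‖a p.1‖ * wt r (p.1 : Euc n × Euc m).2) *
        (‖a p.2‖ * wt r (p.2 : Euc n × Euc m).2))) := by
  obtain ⟨Q, hQ, hle⟩ := exists_norm_pair_le hV.bounded hφ r a
  refine ⟨Q * ∫ z, ‖φ z‖, by positivity, fun ε hε p => ?_⟩
  have hint := (integrable_dil φ hε.1 (p.1 : Euc n × Euc m).2).norm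
  have hw1 := wt_pos r (p.1 : Euc n × Euc m).2
  have hw2 := wt_pos r (p.2 : Euc n × Euc m).2
  set q := (‖a p.1‖ * wt r (p.1 : Euc n × Euc m).2) * (‖a p.2‖ * wt r (p.2 : Euc n × Euc m).2)
    with hq
  have hq0 : 0 ≤ q := by positivity
  calc _ ≤ ∫ y in V, Q * q * ‖dil φ ε (p.1 : Euc n × Euc m).2 y‖ := by
        refine integral_mono_ae (integrableOn_pair φ hV.bounded a ε p).norm
          (hint.integrableOn.const_mul _) ?_
        filter_upwards [ae_restrict_mem₀ hV.nullMeasurableSet] with y hy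
        exact hle ε hε p y hy
    _ ≤ ∫ y, Q * q * ‖dil φ ε (p.1 : Euc n × Euc m).2 y‖ :=
        setIntegral_le_integral (hint.const_mul _) (ae_of_all _ fun y => by positivity)
    _ = Q * q * (ε ^ m * ∫ z, ‖φ z‖) := by
        rw [integral_const_mul]
        congr 1
        exact integral_comp_dil (fun z => ‖φ z‖) hε.1 _
    _ = _ := by ring

theorem summable_mul_dil (hV : Bornology.IsBounded V)
    (hφ : ∀ x ∉ Metric.ball u (1 / 2), φ x = 0)
    (ha : Summable fun x : Γ => ‖a x‖ * wt r (x : Euc n × Euc m).2) {ε : ℝ}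
    (hε : ε ∈ Set.Ioo (0 : ℝ) 1) {y : Euc m} (hy : y ∈ V) :
    Summable fun x : Γ => ‖a x * dil φ ε (x : Euc n × Euc m).2 y‖ := by
  obtain ⟨K, hK, hwt⟩ := exists_one_le_wt_of_dil_ne_zero hV hφ r
  obtain ⟨M, hM, hle⟩ := exists_norm_dil_le φ
  refine Summable.of_nonneg_of_le (fun _ => norm_nonneg _) (fun x => ?_) (ha.mul_left (M * K))
  have hw := wt_pos r (x : Euc n × Euc m).2
  by_cases h : dil φ ε (x : Euc n × Euc m).2 y = 0
  · rw [h, mul_zero, norm_zero]; positivity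
  · have h1 := hwt ε hε _ y hy h
    rw [norm_mul]
    calc _ ≤ ‖a x‖ * (M * (K * wt r (x : Euc n × Euc m).2)) := by
          gcongr
          exact (hle _ _ _).trans (le_mul_of_one_le_right hM h1)
      _ = _ := by ring

/-- The square integral of a sum of bumps as a sum over pairs. -/
theorem integral_norm_sq_tsum_dil [Countable Γ] (hV : RiemannMeasurable V)
    (hφ : ∀ x ∉ Metric.ball u (1 / 2), φ x = 0)
    (ha : Summable fun x : Γ => ‖a x‖ * wt r (x : Euc n × Euc m).2) {ε : ℝ}
    (hε : ε ∈ Set.Ioo (0 : ℝ) 1) :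
    ((∫ y in V, ‖∑' x : Γ, a x * dil φ ε (x : Euc n × Euc m).2 y‖ ^ 2 : ℝ) : ℂ) =
      ∑' p, pairTerm φ V a ε p := by
  obtain ⟨Q, hQ, hle⟩ := exists_integral_norm_pair_le hV hφ r a
  unfold pairTerm
  rw [integral_tsum_of_summable_integral_norm, ← integral_complex_ofReal]
  · refine integral_congr_ae ?_
    filter_upwards [ae_restrict_mem₀ hV.nullMeasurableSet] with y hy
    have hs := summable_mul_dil hV.bounded hφ ha hε hy
    rw [← tsum_mul_tsum_of_summable_norm hs (g := fun x : Γ =>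
      (starRingEnd ℂ) (a x * dil φ ε (x : Euc n × Euc m).2 y)) (by simpa only [RCLike.norm_conj] using hs),
      ← Complex.conj_tsum, Complex.mul_conj']
    push_cast
    rfl
  · exact fun p => integrableOn_pair φ hV.bounded a ε p
  · have hp := ((ha.mul_of_nonneg ha (fun x => mul_nonneg (norm_nonneg _) (wt_pos _ _).le)
      (fun x => mul_nonneg (norm_nonneg _) (wt_pos _ _).le)).mul_left Q).mul_left (ε ^ m)
    exact Summable.of_nonneg_of_le (fun p => by positivity) (hle ε hε) hp

/-- Each rescaled pair is eventually constant: distinct points have disjoint bumps, and a single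
bump is eventually inside V or vanishes on V, by the window property. -/
theorem tendsto_pairTerm (hΓ : Set.InjOn Prod.snd (Γ : Set (Euc n × Euc m)))
    (hu : IsWindow Γ V u) (hφ : ∀ x ∉ Metric.ball u (1 / 2), φ x = 0) (p : Γ × Γ) :
    Tendsto (fun ε : ℝ => ((ε ^ m : ℝ) : ℂ)⁻¹ * pairTerm φ V a ε p) (𝓝[>] 0)
      (𝓝 ((Set.range fun x : Γ => (x, x)).indicator (fun p => (((∫ z, ‖φ z‖ ^ 2) *
        (latticePointsOver Γ V).indicator (fun x => ‖a x‖ ^ 2) p.1 : ℝ) : ℂ)) p)) := by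
  refine tendsto_const_nhds.congr' ?_
  obtain ⟨x, x'⟩ := p
  by_cases hxx : x = x'
  · subst hxx
    rw [Set.indicator_of_mem (Set.mem_range_self x)]
    have e (ε : ℝ) : pairTerm φ V a ε (x, x) =
        ((‖a x‖ ^ 2 * ∫ y in V, ‖dil φ ε (x : Euc n × Euc m).2 y‖ ^ 2 : ℝ) : ℂ) := by
      rw [← integral_const_mul, ← integral_complex_ofReal, pairTerm]
      refine integral_congr_ae (ae_of_all _ fun y => ?_)
      simp only [Complex.mul_conj', norm_mul]
      push_cast
      ring
    by_cases hx : (x : Euc n × Euc m).2 ∈ V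
    · rw [Set.indicator_of_mem (by exact hx)]
      filter_upwards [hu.eventually_dil_mem hφ x.2 hx, self_mem_nhdsWithin] with ε h (hε : 0 < ε)
      rw [e, setIntegral_eq_integral_of_forall_compl_eq_zero fun y hy => by simp [h y hy],
        integral_norm_sq_dil _ hε, ← Complex.ofReal_inv, ← Complex.ofReal_mul]
      congr 1
      have : ε ^ m ≠ 0 := (pow_pos hε m).ne'
      field_simp
    · rw [Set.indicator_of_notMem (by exact hx)]
      filter_upwards [hu.eventually_dil_notMem hφ x.2 hx] with ε h
      rw [e, setIntegral_eq_zero_of_forall_eq_zero fun y hy => by simp [h y hy]]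
      simp
  · rw [Set.indicator_of_notMem (by rintro ⟨z, hz⟩; exact hxx ((Prod.ext_iff.1 hz).1.symm.trans (Prod.ext_iff.1 hz).2))]
    have hne : (x : Euc n × Euc m).2 ≠ (x' : Euc n × Euc m).2 := fun h =>
      hxx (Subtype.ext (hΓ x.2 x'.2 h))
    filter_upwards [eventually_dil_disjoint hφ hne] with ε h
    rw [pairTerm, setIntegral_eq_zero_of_forall_eq_zero, mul_zero]
    intro y _
    rw [map_mul, mul_mul_mul_comm, h y, mul_zero]

/-- Dominated convergence for series over pairs: after division by ε^m the majorant is independent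
of ε, and only the diagonal survives. -/
theorem tendsto_integral_norm_sq_tsum_dil [Countable Γ]
    (hΓ : Set.InjOn Prod.snd (Γ : Set (Euc n × Euc m))) (hV : RiemannMeasurable V)
    (hu : IsWindow Γ V u) (hφ : ∀ x ∉ Metric.ball u (1 / 2), φ x = 0)
    (ha : Summable fun x : Γ => ‖a x‖ * wt r (x : Euc n × Euc m).2) :
    Tendsto (fun ε : ℝ => (ε ^ m)⁻¹ *
      ∫ y in V, ‖∑' x : Γ, a x * dil φ ε (x : Euc n × Euc m).2 y‖ ^ 2) (𝓝[>] 0)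
      (𝓝 ((∫ z, ‖φ z‖ ^ 2) * ∑' x, (latticePointsOver Γ V).indicator (fun x => ‖a x‖ ^ 2) x)) := by
  obtain ⟨Q, hQ, hle⟩ := exists_integral_norm_pair_le hV hφ r a
  have hlim := tendsto_tsum_of_dominated_convergence
    ((ha.mul_of_nonneg ha (fun x => mul_nonneg (norm_nonneg _) (wt_pos _ _).le)
      (fun x => mul_nonneg (norm_nonneg _) (wt_pos _ _).le)).mul_left Q)
    (fun p => tendsto_pairTerm (a := a) hΓ hu hφ p) (by
      filter_upwards [Ioo_mem_nhdsGT one_pos] with ε hε p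
      have hεm : 0 < ε ^ m := pow_pos hε.1 m
      rw [norm_mul, norm_inv, Complex.norm_real, Real.norm_of_nonneg hεm.le,
        inv_mul_le_iff₀ hεm]
      exact (norm_integral_le_integral_norm _).trans (hle ε hε p))
  have hdiag : ∑' p : Γ × Γ, (Set.range fun x : Γ => (x, x)).indicator (fun p => (((∫ z, ‖φ z‖ ^ 2) *
        (latticePointsOver Γ V).indicator (fun x => ‖a x‖ ^ 2) p.1 : ℝ) : ℂ)) p =
      (((∫ z, ‖φ z‖ ^ 2) * ∑' x, (latticePointsOver Γ V).indicator (fun x => ‖a x‖ ^ 2) x : ℝ) : ℂ) := by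
    have hinj : Function.Injective fun x : Γ => (x, x) := fun x y h => (Prod.ext_iff.1 h).1
    rw [← hinj.tsum_eq Set.support_indicator_subset, ← tsum_mul_left, Complex.ofReal_tsum]
    exact tsum_congr fun x => Set.indicator_of_mem (Set.mem_range_self x) _
  rw [hdiag] at hlim
  refine ((Complex.continuous_re.tendsto _).comp hlim).congr' ?_
  filter_upwards [Ioo_mem_nhdsGT one_pos] with ε hε
  simp only [Function.comp_apply]
  rw [tsum_mul_left, ← integral_norm_sq_tsum_dil hV hφ ha hε, ← Complex.ofReal_inv,
    ← Complex.ofReal_mul, Complex.ofReal_re]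

end BumpSums

/-! ### From a Riesz sequence over V to a frame over U. -/

section RieszToFrame

variable {n m : ℕ} {Γ : Submodule ℤ (Euc n × Euc m)}

/-- The Riesz sequence inequalities extend to absolutely summable families of coefficients. -/
theorem riesz_inequality_tsum {k : ℕ} {Lam : Set (Euc k)} [Countable Lam] {S : Set (Euc k)}
    (hS : Bornology.IsBounded S) {A B : ℝ}
    (h : ∀ (s : Finset Lam) (c : Lam → ℂ),
      A * ∑ i ∈ s, ‖c i‖ ^ 2 ≤ ‖∑ i ∈ s, c i • expSystem Lam hS i‖ ^ 2 ∧
      ‖∑ i ∈ s, c i • expSystem Lam hS i‖ ^ 2 ≤ B * ∑ i ∈ s, ‖c i‖ ^ 2)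
    {c : Lam → ℂ} (hc : Summable fun i => ‖c i‖) :
    A * ∑' i, ‖c i‖ ^ 2 ≤ ∫ x in S, ‖∑' i, c i * expFun (i : Euc k) x‖ ^ 2 ∧
      ∫ x in S, ‖∑' i, c i * expFun (i : Euc k) x‖ ^ 2 ≤ B * ∑' i, ‖c i‖ ^ 2 := by
  have : IsFiniteMeasure (volume.restrict S) :=
    ⟨by rw [Measure.restrict_apply_univ]; exact hS.measure_lt_top⟩
  set M := ∑' i, ‖c i‖ with hM
  have hsq : Summable fun i => ‖c i‖ ^ 2 := by
    refine Summable.of_nonneg_of_le (fun _ => by positivity) (fun i => ?_) (hc.mul_left M)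
    rw [sq]
    exact mul_le_mul_of_nonneg_right (hc.le_tsum i fun _ _ => norm_nonneg _) (norm_nonneg _)
  have hsum (x : Euc k) : Summable fun i => c i * expFun (i : Euc k) x :=
    Summable.of_norm (by simpa only [norm_mul, norm_expFun, mul_one] using hc)
  have hlim : Tendsto (fun s : Finset Lam => ‖∑ i ∈ s, c i • expSystem Lam hS i‖ ^ 2) atTop
      (𝓝 (∫ x in S, ‖∑' i, c i * expFun (i : Euc k) x‖ ^ 2)) := by
    simp only [norm_sq_sum_expSystem]
    refine tendsto_integral_filter_of_dominated_convergence (fun _ => M ^ 2)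
      (Eventually.of_forall fun s => ?_) (Eventually.of_forall fun s => ae_of_all _ fun x => ?_)
      (integrable_const _) (ae_of_all _ fun x => ?_)
    · exact ((continuous_finsetSum _ fun i _ =>
        continuous_const.mul (continuous_expFun _)).norm.pow 2).aestronglyMeasurable
    · rw [Real.norm_of_nonneg (by positivity)]
      gcongr
      refine (norm_sum_le _ _).trans ?_
      simp only [norm_mul, norm_expFun, mul_one]
      exact hc.sum_le_tsum s fun _ _ => norm_nonneg _
    · exact (Filter.Tendsto.norm (hsum x).hasSum).pow 2
  exact ⟨le_of_tendsto_of_tendsto' (Tendsto.const_mul A hsq.hasSum) hlim fun s => (h s c).1,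
    le_of_tendsto_of_tendsto' hlim (Tendsto.const_mul B hsq.hasSum) fun s => (h s c).2⟩

theorem fourier_fourier_schwartz (φ : 𝓢(Euc m, ℂ)) (z : Euc m) :
    𝓕 ((𝓕 φ : 𝓢(Euc m, ℂ)) : Euc m → ℂ) z = φ (-z) := by
  have h : 𝓕⁻ (𝓕 φ) = φ := FourierTransform.fourierInv_fourier_eq φ
  have h2 : (𝓕⁻ (𝓕 φ) : 𝓢(Euc m, ℂ)) (-z) = φ (-z) := by rw [h]
  rw [SchwartzMap.fourierInv_coe, Real.fourierInv_eq_fourier_neg, neg_neg] at h2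
  exact h2

variable [DiscreteTopology Γ] [IsZLattice ℝ Γ]

theorem countable_lattice (Γ : Submodule ℤ (Euc n × Euc m)) [DiscreteTopology Γ]
    [IsZLattice ℝ Γ] : Countable Γ :=
  (latticeBasis Γ).equivFun.symm.toEquiv.surjective.countable

theorem countable_dualLattice (Γ : Submodule ℤ (Euc n × Euc m)) [DiscreteTopology Γ]
    [IsZLattice ℝ Γ] : Countable (dualLattice Γ) :=
  (dualLatticeEquiv Γ).surjective.countable

/-- The trigonometric sum over the dual lattice is a sum of bumps at the lattice points. -/
theorem tsum_expFun_eq_tsum_dil (f : 𝓢(Euc n, ℂ)) (φ : 𝓢(Euc m, ℂ)) {ε : ℝ} (hε : 0 < ε)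
    (z : Euc m) :
    ∑' y : dualLattice Γ, f (y : Euc n × Euc m).1 * (𝓕 φ) (ε • (y : Euc n × Euc m).2) *
        expFun (y : Euc n × Euc m).2 z =
      (poissonConst Γ * (ε ^ m)⁻¹ : ℝ) * ∑' x : Γ, 𝓕 (f : Euc n → ℂ) (x : Euc n × Euc m).1 *
        dil φ ε (x : Euc n × Euc m).2 z := by
  -- Applied to φ̂, Poisson summation produces the double transform φ(-·); the reflection turns the
  -- argument ε⁻¹(p₂γ - z) into that of a bump at p₂γ.
  have h := poisson_modulated Γ f (𝓕 φ) hε z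
  rw [← Complex.ofReal_mul] at h
  convert! h using 1
  · refine tsum_congr fun y => ?_
    rw [expFun_comm, mul_assoc, mul_comm (expFun _ _)]
  · congr 1
    refine tsum_congr fun x => ?_
    rw [fourier_fourier_schwartz, dil, neg_add, neg_neg, smul_sub, sub_eq_add_neg]

/-- Since f vanishes off U, the sum over the dual model set is a full sum over Γ*, to which Poisson
summation applies. Multiplying through by ε^m gives both sides finite limits. -/
theorem riesz_inequality_strip (hΓ : GeneralPosition Γ) {U : Set (Euc n)} {V : Set (Euc m)}
    (hV : Bornology.IsBounded V) {A B : ℝ}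
    (h : ∀ (s : Finset (dualModelSet Γ U)) (c : dualModelSet Γ U → ℂ),
      A * ∑ i ∈ s, ‖c i‖ ^ 2 ≤ ‖∑ i ∈ s, c i • expSystem (dualModelSet Γ U) hV i‖ ^ 2 ∧
      ‖∑ i ∈ s, c i • expSystem (dualModelSet Γ U) hV i‖ ^ 2 ≤ B * ∑ i ∈ s, ‖c i‖ ^ 2)
    {f : 𝓢(Euc n, ℂ)} (hf : ∀ x ∉ U, f x = 0) (φ : 𝓢(Euc m, ℂ)) {ε : ℝ} (hε : 0 < ε) :
    A * (ε ^ m * ∑' y, stripTerm Γ f (𝓕 (φ : Euc m → ℂ)) ε y) ≤ poissonConst Γ ^ 2 * ((ε ^ m)⁻¹ *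
      ∫ y in V, ‖∑' x : Γ, 𝓕 (f : Euc n → ℂ) (x : Euc n × Euc m).1 *
        dil φ ε (x : Euc n × Euc m).2 y‖ ^ 2) ∧
    poissonConst Γ ^ 2 * ((ε ^ m)⁻¹ *
      ∫ y in V, ‖∑' x : Γ, 𝓕 (f : Euc n → ℂ) (x : Euc n × Euc m).1 *
        dil φ ε (x : Euc n × Euc m).2 y‖ ^ 2) ≤
      B * (ε ^ m * ∑' y, stripTerm Γ f (𝓕 (φ : Euc m → ℂ)) ε y) := by
  have := countable_dualLattice Γ
  have : Countable (dualModelSet Γ U) := (dualModelSetEquiv hΓ U).surjective.countable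
  set C : dualLattice Γ → ℂ := fun y =>
    f (y : Euc n × Euc m).1 * (𝓕 φ) (ε • (y : Euc n × Euc m).2) with hC
  have hCs : Summable C := summable_schwartz_dualLattice Γ f (𝓕 φ) hε
  have hC0 : Function.support C ⊆ pointsOver Γ U := by
    intro y hy
    by_contra hyU
    exact hy (by rw [hC]; simp only; rw [hf _ hyU, zero_mul])
  set c : dualModelSet Γ U → ℂ := fun i => C ((dualModelSetEquiv hΓ U).symm i) with hc
  have hcs : Summable fun i => ‖c i‖ := by
    rw [← (dualModelSetEquiv hΓ U).summable_iff]
    simp only [hc, Function.comp_def, Equiv.symm_apply_apply]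
    exact hCs.norm.subtype (pointsOver Γ U)
  have e1 : ∑' i, ‖c i‖ ^ 2 = ∑' y, stripTerm Γ f (𝓕 (φ : Euc m → ℂ)) ε y := by
    rw [← (dualModelSetEquiv hΓ U).tsum_eq]
    simp only [hc, Equiv.symm_apply_apply]
    rw [tsum_subtype_eq_of_support_subset (f := fun y => ‖C y‖ ^ 2) (s := pointsOver Γ U)]
    · refine tsum_congr fun y => ?_
      rw [hC, norm_mul, mul_pow]
      rfl
    · intro y hy
      refine hC0 fun h0 => hy ?_
      simp [h0]
  have e2 (z : Euc m) : ∑' i, c i * expFun (i : Euc m) z =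
      (poissonConst Γ * (ε ^ m)⁻¹ : ℝ) * ∑' x : Γ, 𝓕 (f : Euc n → ℂ) (x : Euc n × Euc m).1 *
        dil φ ε (x : Euc n × Euc m).2 z := by
    rw [← tsum_expFun_eq_tsum_dil f φ hε, ← (dualModelSetEquiv hΓ U).tsum_eq]
    simp only [hc, Equiv.symm_apply_apply, coe_dualModelSetEquiv]
    exact tsum_subtype_eq_of_support_subset
      (f := fun y : dualLattice Γ => C y * expFun (y : Euc n × Euc m).2 z) (s := pointsOver Γ U)
      fun y hy => hC0 (left_ne_zero_of_mul hy)
  have e3 : ∫ z in V, ‖∑' i, c i * expFun (i : Euc m) z‖ ^ 2 =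
      (ε ^ m)⁻¹ * (poissonConst Γ ^ 2 * ((ε ^ m)⁻¹ *
      ∫ y in V, ‖∑' x : Γ, 𝓕 (f : Euc n → ℂ) (x : Euc n × Euc m).1 *
        dil φ ε (x : Euc n × Euc m).2 y‖ ^ 2)) := by
    simp only [e2, norm_mul, Complex.norm_real, mul_pow, Real.norm_eq_abs, sq_abs]
    rw [integral_const_mul]
    ring
  have key := riesz_inequality_tsum hV h hcs
  rw [e1, e3] at key
  have hεm : 0 < ε ^ m := pow_pos hε m
  rw [le_inv_mul_iff₀ hεm, inv_mul_le_iff₀ hεm, mul_left_comm, mul_left_comm _ B] at key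
  exact key

theorem summable_fourier_mul_wt (f : 𝓢(Euc n, ℂ)) : Summable fun x : Γ =>
    ‖𝓕 (f : Euc n → ℂ) (x : Euc n × Euc m).1‖ * wt (n + m + 1) (x : Euc n × Euc m).2 := by
  obtain ⟨-, C, hC, h⟩ := decays_fourier_schwartz (n + m + 1) f
  refine Summable.of_nonneg_of_le (fun x => mul_nonneg (norm_nonneg _) (wt_pos _ _).le)
    (fun x => ?_) ((summable_wt_mul_wt Γ (r := n + m + 1) (by omega)).mul_left C)
  rw [← mul_assoc]
  exact mul_le_mul_of_nonneg_right (h _) (wt_pos _ _).le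

theorem summable_fourier_norm_sq (f : 𝓢(Euc n, ℂ)) {V : Set (Euc m)}
    (hV : Bornology.IsBounded V) : Summable ((latticePointsOver Γ V).indicator fun x =>
      ‖𝓕 (f : Euc n → ℂ) (x : Euc n × Euc m).1‖ ^ 2) := by
  obtain ⟨-, C, hC, h⟩ := decays_fourier_schwartz 0 f
  obtain ⟨R, hR⟩ := hV.exists_norm_le
  refine Summable.of_nonneg_of_le (fun x => Set.indicator_nonneg (fun _ _ => by positivity) x)
    (fun x => ?_) ((summable_fourier_mul_wt f).mul_left (C * (1 + |R|) ^ (n + m + 1)))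
  have hw := wt_pos (n + m + 1) (x : Euc n × Euc m).2
  by_cases hx : x ∈ latticePointsOver Γ V
  · rw [Set.indicator_of_mem hx]
    -- Over bounded V the weight of p₂γ is bounded below, so it can be inserted to use summability
    -- over all of Γ.
    have h1 : 1 ≤ (1 + |R|) ^ (n + m + 1) * wt (n + m + 1) (x : Euc n × Euc m).2 := by
      rw [wt, ← div_eq_mul_inv, one_le_div (by positivity)]
      gcongr
      exact (hR _ hx).trans (le_abs_self R)
    have h2 : ‖𝓕 (f : Euc n → ℂ) (x : Euc n × Euc m).1‖ ≤ C := by simpa [wt] using h _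
    calc ‖𝓕 (f : Euc n → ℂ) (x : Euc n × Euc m).1‖ ^ 2
        ≤ C * ‖𝓕 (f : Euc n → ℂ) (x : Euc n × Euc m).1‖ * 1 := by
          rw [sq, mul_one]
          gcongr
      _ ≤ C * ‖𝓕 (f : Euc n → ℂ) (x : Euc n × Euc m).1‖ *
          ((1 + |R|) ^ (n + m + 1) * wt (n + m + 1) (x : Euc n × Euc m).2) := by gcongr
      _ = _ := by ring
  · rw [Set.indicator_of_notMem hx]
    positivity

/-- The classes of Schwartz functions vanishing outside `U`. -/
def schwartzOn {U : Set (Euc n)} (hU : Bornology.IsBounded U) :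
    Submodule ℂ (Lp ℂ 2 (volume.restrict U)) where
  carrier := {F | ∃ f : 𝓢(Euc n, ℂ), (∀ x ∉ U, f x = 0) ∧
    F = (memLp_of_continuous hU f.continuous).toLp f}
  zero_mem' := ⟨0, fun _ _ => rfl, (MemLp.toLp_zero _).symm⟩
  add_mem' := by
    rintro _ _ ⟨f, hf, rfl⟩ ⟨g, hg, rfl⟩
    exact ⟨f + g, fun x hx => by simp [hf x hx, hg x hx], (MemLp.toLp_add _ _).symm⟩
  smul_mem' := by
    rintro c _ ⟨f, hf, rfl⟩
    exact ⟨c • f, fun x hx => by simp [hf x hx], (MemLp.toLp_const_smul _ _).symm⟩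

/-- A function orthogonal to this subspace integrates to 0 against every smooth function compactly
supported in the interior of U, so it vanishes almost everywhere there, and the rest of U is null.
-/
theorem dense_schwartzOn {U : Set (Euc n)} (hU : RiemannMeasurable U) :
    Dense (schwartzOn hU.bounded : Set (Lp ℂ 2 (volume.restrict U))) := by
  rw [Submodule.dense_iff_topologicalClosure_eq_top, Submodule.topologicalClosure_eq_top_iff,
    eq_bot_iff]
  intro g hg
  have : IsFiniteMeasure (volume.restrict U) :=
    ⟨by rw [Measure.restrict_apply_univ]; exact hU.bounded.measure_lt_top⟩
  have hgi : Integrable g (volume.restrict U) := (Lp.memLp g).integrable (by norm_num)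
  have h0 := isOpen_interior.ae_eq_zero_of_integral_contDiff_smul_eq_zero
    (U := interior U) (f := g) (μ := volume.restrict U)
    (hgi.locallyIntegrable.locallyIntegrableOn _) fun b hb hbc hbU => by
      have hs : HasCompactSupport fun x => (b x : ℂ) := hbc.comp_left (g := Complex.ofReal) rfl
      have hc : ContDiff ℝ ((⊤ : ℕ∞) : WithTop ℕ∞) fun x => (b x : ℂ) :=
        Complex.ofRealCLM.contDiff.comp hb
      have hmem : (memLp_of_continuous hU.bounded (hs.toSchwartzMap hc).continuous).toLp
          (hs.toSchwartzMap hc) ∈ schwartzOn hU.bounded := by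
        refine ⟨_, fun x hx => ?_, rfl⟩
        change (b x : ℂ) = 0
        rw [image_eq_zero_of_notMem_tsupport fun h => hx (interior_subset (hbU h)),
          Complex.ofReal_zero]
      have h1 := (Submodule.mem_orthogonal _ _).1 hg _ hmem
      rw [L2.inner_def] at h1
      rw [← h1]
      refine integral_congr_ae ?_
      filter_upwards [(memLp_of_continuous hU.bounded
        (hs.toSchwartzMap hc).continuous).coeFn_toLp] with x hx
      have hbx : (hs.toSchwartzMap hc) x = (b x : ℂ) := rfl
      rw [hx, hbx, RCLike.inner_apply, Complex.conj_ofReal, Complex.real_smul, mul_comm]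
  have hint : ∀ᵐ x ∂(volume.restrict U), x ∈ interior U := by
    rw [← Measure.restrict_congr_set (interior_ae_eq_of_null_frontier hU.null_frontier)]
    exact ae_restrict_mem isOpen_interior.measurableSet
  rw [Submodule.mem_bot, Lp.eq_zero_iff_ae_eq_zero]
  filter_upwards [h0, hint] with x hx hxU using hx hxU

/-- The two limits carry C ∫|φ|² and C² ∫|φ|² respectively; cancelling C ∫|φ|² leaves A/C and B/C on
a dense subspace. -/
theorem isFrame_of_isRieszSequence (hΓ : GeneralPosition Γ) {U : Set (Euc n)}
    (hU : RiemannMeasurable U) {V : Set (Euc m)} (hV : RiemannMeasurable V) {u : Euc m}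
    (hu : IsWindow Γ V u) (hF : IsRieszSequence (expSystem (dualModelSet Γ U) hV.bounded)) :
    IsFrame (expSystem (modelSet Γ V) hU.bounded) := by
  obtain ⟨A, B, hA, hB, hF⟩ := hF
  obtain ⟨φ, hφ, hφ0⟩ := exists_schwartz_bump u
  have hC := poissonConst_pos Γ
  have := countable_lattice Γ
  refine IsFrame.of_dense (dense_schwartzOn hU) (div_pos hA hC) (div_pos hB hC) ?_
  rintro _ ⟨f, hf, rfl⟩
  have hnorm : ‖(memLp_of_continuous hU.bounded f.continuous).toLp f‖ ^ 2 = ∫ x, ‖f x‖ ^ 2 := by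
    rw [norm_sq_toLp, setIntegral_eq_integral_of_forall_compl_eq_zero fun x hx => by simp [hf x hx]]
  have hcoef (x : latticePointsOver Γ V) :
      ‖(inner ℂ (expSystem (modelSet Γ V) hU.bounded (modelSetEquiv hΓ V x))
        ((memLp_of_continuous hU.bounded f.continuous).toLp f) : ℂ)‖ ^ 2 =
      ‖𝓕 (f : Euc n → ℂ) (x.1 : Euc n × Euc m).1‖ ^ 2 := by
    rw [inner_expSystem_toLp, coe_modelSetEquiv, fourier_eq_integral_expFun,
      setIntegral_eq_integral_of_forall_compl_eq_zero fun x hx => by simp [hf x hx]]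
  have hs := summable_fourier_norm_sq (Γ := Γ) f hV.bounded
  have hsum : ∑' i, ‖(inner ℂ (expSystem (modelSet Γ V) hU.bounded i)
        ((memLp_of_continuous hU.bounded f.continuous).toLp f) : ℂ)‖ ^ 2 =
      ∑' x, (latticePointsOver Γ V).indicator
        (fun x => ‖𝓕 (f : Euc n → ℂ) (x : Euc n × Euc m).1‖ ^ 2) x := by
    rw [← (modelSetEquiv hΓ V).tsum_eq, ← tsum_subtype]
    exact tsum_congr hcoef
  have hl1 := tendsto_tsum_stripTerm hΓ f φ
  have hl2 := (tendsto_integral_norm_sq_tsum_dil hΓ.injOn_snd hV hu hφ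
    (summable_fourier_mul_wt f)).const_mul (poissonConst Γ ^ 2)
  have hineq : ∀ᶠ ε : ℝ in 𝓝[>] 0, 0 < ε := self_mem_nhdsWithin
  have h1 := le_of_tendsto_of_tendsto (hl1.const_mul A) hl2 (hineq.mono fun ε hε =>
    (riesz_inequality_strip hΓ hV.bounded hF hf φ hε).1)
  have h2 := le_of_tendsto_of_tendsto hl2 (hl1.const_mul B) (hineq.mono fun ε hε =>
    (riesz_inequality_strip hΓ hV.bounded hF hf φ hε).2)
  rw [hsum, hnorm, div_mul_eq_mul_div, div_mul_eq_mul_div, div_le_iff₀ hC, le_div_iff₀ hC]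
  have hCφ := mul_pos hC hφ0
  refine ⟨?_, ?_, ?_⟩
  · rw [← (modelSetEquiv hΓ V).summable_iff]
    exact (summable_subtype_iff_indicator.2 hs).congr fun x => (hcoef x).symm
  · exact le_of_mul_le_mul_right (by linarith) hCφ
  · exact le_of_mul_le_mul_right (by linarith) hCφ

end RieszToFrame

end ModelSetDuality

/-! ### Assembly of the three implications. -/

theorem mainTheorem4 {n m : ℕ}
    (Γ : Submodule ℤ (ModelSetDuality.Euc n × ModelSetDuality.Euc m))
    [DiscreteTopology Γ] [IsZLattice ℝ Γ]
    (hΓ : ModelSetDuality.GeneralPosition Γ)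
    (U : Set (ModelSetDuality.Euc n)) (hU : ModelSetDuality.RiemannMeasurable U)
    (V : Set (ModelSetDuality.Euc m)) (hV : ModelSetDuality.RiemannMeasurable V)
    (hVΓ : frontier V ∩ Prod.snd '' (Γ : Set (ModelSetDuality.Euc n × ModelSetDuality.Euc m)) = ∅ ∨
      ModelSetDuality.IsSemiClosedInterval V) :
    (ModelSetDuality.IsFrame
        (ModelSetDuality.expSystem (ModelSetDuality.dualModelSet Γ U) hV.bounded) →
      ModelSetDuality.IsRieszSequence
        (ModelSetDuality.expSystem (ModelSetDuality.modelSet Γ V) hU.bounded)) ∧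
    (ModelSetDuality.IsRieszSequence
        (ModelSetDuality.expSystem (ModelSetDuality.dualModelSet Γ U) hV.bounded) →
      ModelSetDuality.IsFrame
        (ModelSetDuality.expSystem (ModelSetDuality.modelSet Γ V) hU.bounded)) ∧
    (ModelSetDuality.IsRieszBasis
        (ModelSetDuality.expSystem (ModelSetDuality.dualModelSet Γ U) hV.bounded) →
      ModelSetDuality.IsRieszBasis
        (ModelSetDuality.expSystem (ModelSetDuality.modelSet Γ V) hU.bounded)) := by
  -- The two alternatives for V differ only in the direction of approach; u = 0 serves when no
  -- projected lattice point lies on the boundary.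
  obtain ⟨u, hu⟩ : ∃ u, ModelSetDuality.IsWindow Γ V u :=
    hVΓ.elim (fun h => ⟨0, ModelSetDuality.isWindow_of_frontier h⟩)
      ModelSetDuality.isWindow_of_semiClosed
  have h1 := ModelSetDuality.isRieszSequence_of_isFrame hΓ hU hV hu
  have h2 := ModelSetDuality.isFrame_of_isRieszSequence hΓ hU hV hu
  exact ⟨h1, h2, fun h => (h1 h.isFrame).isRieszBasis (h2 h.isRieszSequence)⟩
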